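/- Let $K$ be an algebraically closed field of characteristic $0$ and let $T\cong\mathbb G_m^r$ be a torus over $K$. Representations are finite-dimensional and algebraic; $K[V]$ is the ring of polynomial functions on $V$, $V/T=\operatorname{Spec}K[V]^T$, and $\pi\colon V\to V/T$ is the quotient map. A vector $v\in V$ is \emph{stable} if its orbit $Tv$ is (Zariski) closed and $v$ is not contained in the closure of any other orbit; $V$ is \emph{stable} if it contains a stable vector, and $V^{\mathrm{sss}}$ denotes the closed set of vectors that are not stable. The representation $V$ is \emph{cofree} if $K[V]$ is a free $K[V]^T$-module. A stable representation $V$ is \emph{cnpure} if every irreducible component $D$ of $V^{\mathrm{sss}}$ has codimension one in $V$, its image $\pi(D)$ is an irreducible closed subset of codimension one in $V/T$, and this divisor is principal, i.e. the ideal of $\pi(D)$ (with its reduced structure) in $K[V]^T$ is principal. (The condition is vacuous if $V^{\mathrm{sss}}=\emptyset$.) Let $V_1$ and $V_2$ be stable representations of $T$, let $V=V_1\oplus V_2$, and assume that $V/T=V_1/T\times V_2/T$, i.e. that the natural morphism $V/T\to V_1/T\times V_2/T$ is an isomorphism (equivalently, the natural map $K[V_1]^T\otimes_K K[V_2]^T\to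 K[V]^T$ is an isomorphism). Then: 1. $V$ is cofree if and only if both $V_1$ and $V_2$ are cofree; 2. $V$ is cnpure if and only if both $V_1$ and $V_2$ are cnpure. -/

import Mathlib

open scoped TensorProduct

noncomputable section

namespace TorusRep

/-! ### Polynomial functions and the Zariski topology on a vector space -/

section Polynomial

variable (K : Type*) [Field K] (V : Type*) [AddCommGroup V] [Module K V]

/-- The coordinate ring `K[V]`: the algebra of functions on `V` generated by the linear forms.
(`K` will be infinite, so that polynomials and polynomial functions are the same.) -/
def polyFun : Subalgebra K (V → K) :=
  Algebra.adjoin K (Set.range fun φ : Module.Dual K V => (φ : V → K))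

/-- The Zariski topology on the set of `K`-points of `V`: closed sets are the common zero sets of
families of polynomial functions. -/
@[reducible]
def zariski : TopologicalSpace V :=
  TopologicalSpace.ofClosed
    {Z | ∃ S : Set (polyFun K V), Z = {v | ∀ f ∈ S, (f : V → K) v = 0}}
    ⟨{1}, by ext v; simp⟩
    (by
      intro A hA
      refine ⟨{f | ∃ Z ∈ A, ∀ v ∈ Z, (f : V → K) v = 0}, ?_⟩
      ext v
      constructor
      · rintro hv f ⟨Z, hZ, hf⟩
        exact hf v (hv Z hZ)
      · intro hv Z hZ
        obtain ⟨S, rfl⟩ := hA hZ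
        intro f hf
        exact hv f ⟨_, hZ, fun w hw => hw f hf⟩)
    (by
      rintro _ ⟨S, rfl⟩ _ ⟨S', rfl⟩
      refine ⟨{h | ∃ f ∈ S, ∃ g ∈ S', h = f * g}, ?_⟩
      ext v
      constructor
      · rintro (hv | hv) _ ⟨f, hf, g, hg, rfl⟩
        · simp [hv f hf]
        · simp [hv g hg]
      · intro hv
        by_contra hcon
        simp only [Set.mem_union, Set.mem_ofPred_eq, not_or, not_forall] at hcon
        obtain ⟨⟨f, hf, hfv⟩, g, hg, hgv⟩ := hcon
        have h0 := hv (f * g) ⟨f, hf, g, hg, rfl⟩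
        simp only [MulMemClass.coe_mul, Pi.mul_apply, mul_eq_zero] at h0
        exact h0.elim hfv hgv)

end Polynomial

/-! ### Irreducible components and prime divisors -/

section Divisors

variable {X : Type*} [TopologicalSpace X]

/-- `D` is an irreducible component of the subset `Z` of `X`. -/
def IsComponentOf (D Z : Set X) : Prop :=
  Maximal (fun E : Set X => IsIrreducible E ∧ E ⊆ Z) D

/-- `D` is an irreducible closed subset of `X` of codimension one. The codimension of an
irreducible closed subset is the supremum of the lengths of the chains of irreducible closed
subsets that start from it. -/
def IsPrimeDivisor (D : Set X) : Prop :=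
  ∃ E : TopologicalSpace.IrreducibleCloseds X, (E : Set X) = D ∧ Order.coheight E = 1

end Divisors

/-! ### Representations of tori -/

/-- The (`K`-points of the) split torus `𝔾ₘ^r`. Over an algebraically closed field every torus
is of this form. -/
abbrev Torus (K : Type*) [Field K] (r : ℕ) : Type _ := Fin r → Kˣ

section Representations

variable {K : Type*} [Field K] {r : ℕ}
variable {V : Type*} [AddCommGroup V] [Module K V]

/-- `ρ` is a representation of algebraic groups: its matrix coefficients are regular functions
on the torus, that is, Laurent polynomials in the coordinates. -/
def IsAlgebraic (ρ : Representation K (Torus K r) V) : Prop :=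
  ∀ (v : V) (φ : Module.Dual K V), ∃ P : (Fin r → ℤ) →₀ K,
    ∀ t : Torus K r, φ (ρ t v) = P.sum fun m a => a * ((∏ i, t i ^ m i : Kˣ) : K)

/-- The orbit of the vector `v`. -/
def orbit (ρ : Representation K (Torus K r) V) (v : V) : Set V :=
  Set.range fun t => ρ t v

/-- `v` is stable: its orbit is closed and `v` is not in the closure of any other orbit. -/
def IsStableVector (ρ : Representation K (Torus K r) V) (v : V) : Prop :=
  @IsClosed V (zariski K V) (orbit ρ v) ∧
    ∀ w : V, orbit ρ w ≠ orbit ρ v → v ∉ @closure V (zariski K V) (orbit ρ w)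

/-- A representation is stable if it contains a stable vector. -/
def IsStable (ρ : Representation K (Torus K r) V) : Prop :=
  ∃ v : V, IsStableVector ρ v

/-- The strictly semi-stable locus: the complement of the set of stable vectors. -/
def sss (ρ : Representation K (Torus K r) V) : Set V :=
  {v | ¬ IsStableVector ρ v}

/-- The ring of invariants `K[V]^T`. -/
def invariants (ρ : Representation K (Torus K r) V) : Subalgebra K (polyFun K V) where
  carrier := {f | ∀ t v, (f : V → K) (ρ t v) = (f : V → K) v}
  mul_mem' := by
    intro f g hf hg t v
    simp [hf t v, hg t v]
  add_mem' := by
    intro f g hf hg t v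
    simp [hf t v, hg t v]
  algebraMap_mem' := by
    intro a t v
    rfl

/-- The quotient `V/T = Spec K[V]^T`. -/
abbrev Quotient (ρ : Representation K (Torus K r) V) : Type _ :=
  PrimeSpectrum (invariants ρ)

/-- Evaluation of invariants at a vector. -/
def evalAt (ρ : Representation K (Torus K r) V) (v : V) : invariants ρ →ₐ[K] K :=
  (Pi.evalAlgHom K (fun _ : V => K) v).comp ((polyFun K V).val.comp (invariants ρ).val)

/-- The quotient map `π : V → V/T` on `K`-points: `v` goes to the ideal of the invariants that
vanish at `v`. -/
def quotientMap (ρ : Representation K (Torus K r) V) (v : V) : Quotient ρ :=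
  PrimeSpectrum.comap (evalAt ρ v).toRingHom ⊥

/-- The image of `D` in the scheme `V/T`: the Zariski closure of the set of closed points `π(D)`.
(Where it is used `D` is closed and invariant, so `π(D)` is the set of all closed points of the
image.) -/
def image (ρ : Representation K (Torus K r) V) (D : Set V) : Set (Quotient ρ) :=
  closure (quotientMap ρ '' D)

/-- `V` is cofree: `K[V]` is a free `K[V]^T`-module. -/
def IsCofree (ρ : Representation K (Torus K r) V) : Prop :=
  Module.Free (invariants ρ) (polyFun K V)

/-- `V` is pure: it is stable and its strictly semi-stable locus is of pure codimension one. -/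
def IsPure (ρ : Representation K (Torus K r) V) : Prop :=
  IsStable ρ ∧
    ∀ D : Set V, @IsComponentOf V (zariski K V) D (sss ρ) → @IsPrimeDivisor V (zariski K V) D

/-- `V` is npure: it is pure and every irreducible component of the strictly semi-stable locus
maps to a divisor in `V/T`. -/
def IsNpure (ρ : Representation K (Torus K r) V) : Prop :=
  IsPure ρ ∧
    ∀ D : Set V, @IsComponentOf V (zariski K V) D (sss ρ) → IsPrimeDivisor (image ρ D)

/-- `V` is cnpure: it is npure and every irreducible component of the strictly semi-stable locus
maps to a principal divisor, that is, the ideal of its (reduced) image in `K[V]^T` is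
principal. -/
def IsCnpure (ρ : Representation K (Torus K r) V) : Prop :=
  IsNpure ρ ∧
    ∀ D : Set V, @IsComponentOf V (zariski K V) D (sss ρ) →
      (PrimeSpectrum.vanishingIdeal (image ρ D)).IsPrincipal

end Representations

/-! ### The comparison map for a direct sum -/

section Sum

variable {K : Type*} [Field K] {r : ℕ}
variable {V : Type*} [AddCommGroup V] [Module K V] {W : Type*} [AddCommGroup W] [Module K W]

/-- Composition with a linear map sends polynomial functions to polynomial functions. -/
theorem comp_mem_polyFun (p : V →ₗ[K] W) {f : W → K} (hf : f ∈ polyFun K W) :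
    (fun v => f (p v)) ∈ polyFun K V := by
  induction hf using Algebra.adjoin_induction with
  | mem f hf =>
    obtain ⟨φ, rfl⟩ := hf
    exact Algebra.subset_adjoin ⟨φ.comp p, rfl⟩
  | algebraMap a => exact (polyFun K V).algebraMap_mem a
  | add f g _ _ hf hg => exact (polyFun K V).add_mem hf hg
  | mul f g _ _ hf hg => exact (polyFun K V).mul_mem hf hg

/-- The pull-back `K[W]^T → K[V]^T` of invariants along an equivariant linear map `V → W`. -/
def pullback (ρ : Representation K (Torus K r) V) (σ : Representation K (Torus K r) W)
    (p : V →ₗ[K] W) (hp : ∀ t v, p (ρ t v) = σ t (p v)) : invariants σ →ₐ[K] invariants ρ where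
  toFun f := ⟨⟨fun v => (f.1 : W → K) (p v), comp_mem_polyFun p f.1.2⟩, by
    intro t v
    change (f.1 : W → K) (p (ρ t v)) = (f.1 : W → K) (p v)
    rw [hp]
    exact f.2 t (p v)⟩
  map_one' := rfl
  map_mul' _ _ := rfl
  map_zero' := rfl
  map_add' _ _ := rfl
  commutes' _ := rfl

/-- The homomorphism `K[V]^T ⊗ K[W]^T → K[V ⊕ W]^T`, `f ⊗ g ↦ ((v, w) ↦ f v * g w)`, which
corresponds to the natural morphism `(V ⊕ W)/T → V/T × W/T`. -/
def comparison (ρ : Representation K (Torus K r) V) (σ : Representation K (Torus K r) W) :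
    invariants ρ ⊗[K] invariants σ →ₐ[K] invariants (ρ.prod σ) :=
  Algebra.TensorProduct.productMap
    (pullback (ρ.prod σ) ρ (LinearMap.fst K V W) fun _ _ => rfl)
    (pullback (ρ.prod σ) σ (LinearMap.snd K V W) fun _ _ => rfl)

/-- `(V ⊕ W)/T = V/T × W/T`: the natural morphism of affine schemes is an isomorphism. -/
def QuotientIsProduct (ρ : Representation K (Torus K r) V)
    (σ : Representation K (Torus K r) W) : Prop :=
  Function.Bijective (comparison ρ σ)

end Sum

end TorusRep

end

/-!
Both properties are read off from a basis of weight vectors, which exists by the linear independence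
of characters (`exists_isWeightBasis`). The invariants are then spanned by the monomials of weight
zero (`mem_invariants_iff`). If `K[V₁]^T ⊗ K[V₂]^T → K[V]^T` is surjective, restricting an invariant
monomial `x ^ a y ^ b` to the slice `y = (1, …, 1)` shows that `x ^ a` and `y ^ b` are invariant
separately (`weightsSplit`); this is the only form in which the hypothesis enters the combinatorics.

*Cofreeness.* Every monomial is the product of an invariant monomial and a reduced one, that is, one
that no nonconstant invariant monomial divides. If these decompositions are unique, the reduced
monomials are a basis of `K[V]` over the invariants. Conversely, if `K[V]` is projective over the
invariants, the relations between the reduced monomials form a direct summand `N` of a free module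
with `N = I N` for the ideal `I` of the origin, and so `N = 0` by Krull's intersection theorem. Thus
`V` is cofree if and only if the decompositions are unique (`isCofree_iff`), and uniqueness for
`V₁ ⊕ V₂` is uniqueness for both summands.

*Stable vectors.* A vector with support `S` is stable if and only if every coordinate `i` occurs in
an invariant monomial in the variables from `S ∪ {i}` (`isStableVector_iff`). If it does, the
fibre of the quotient map is a single orbit, since characters extend from a subgroup of the
character lattice by the divisibility of the multiplicative group. If it does not, Farkas' lemma
gives a one-parameter subgroup whose limit shows that the vector is not stable. Hence `(v₁, v₂)` is
stable if and only if `v₁` and `v₂` are, the strictly semi-stable loci are closed, and the components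
of that of `V₁ ⊕ V₂` are the sets `D₁ × V₂` and `V₁ × D₂` with `D₁`, `D₂` components of those of
`V₁`, `V₂` (`isComponentOf_union_iff`).

*Cnpureness.* As `K[V]` is factorial, a closed irreducible set is a prime divisor if and only if its
ideal is principal and nonzero (`isPrimeDivisor_zariski_iff`). In `K[V]^T` a principal nonzero prime
ideal that generates a proper ideal of `K[V]` has height one (`isPrimeDivisor_image_iff`). So `V` is
cnpure if and only if for each component `D` the ideals of `D` in `K[V]` and in `K[V]^T` are principal
and nonzero (`isCnpure_iff`), and both conditions pass between `D₁` and `D₁ × V₂`: a generator extends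
to the product, and a generator on the product restricts to a slice
(`IsProductOf.isPrincipal_vanishing_iff`).
-/

/-! ### Linear inequalities -/

/-- **Farkas' lemma** for finitely many linear forms over an ordered field: a linear form that is
nonpositive wherever the given ones are is a nonnegative combination of them. -/
theorem exists_nonneg_combination {F W J : Type*} [Field F] [LinearOrder F] [IsStrictOrderedRing F]
    [AddCommGroup W] [Module F W] (s : Finset J) (A : J → W →ₗ[F] F) (b : W →ₗ[F] F)
    (h : ∀ x, (∀ j ∈ s, A j x ≤ 0) → b x ≤ 0) :
    ∃ u : J → F, (∀ j, 0 ≤ u j) ∧ b = ∑ j ∈ s, u j • A j := by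
  classical
  induction s using Finset.induction_on generalizing A b with
  | empty =>
    refine ⟨0, fun _ => le_rfl, ?_⟩
    ext x
    have h1 := h x (by simp)
    have h2 := h (-x) (by simp)
    rw [map_neg] at h2
    simp only [Finset.sum_empty, LinearMap.zero_apply]
    linarith
  | insert k s hk ih =>
    by_cases h0 : ∀ x, (∀ j ∈ s, A j x ≤ 0) → b x ≤ 0
    · obtain ⟨u, hu, hb⟩ := ih A b h0
      refine ⟨Function.update u k 0, fun j => ?_, ?_⟩
      · by_cases hj : j = k
        · subst hj; simp
        · simpa [hj] using hu j
      · rw [Finset.sum_insert hk, Function.update_self, zero_smul, zero_add, hb]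
        refine Finset.sum_congr rfl fun j hj => ?_
        rw [Function.update_of_ne (ne_of_mem_of_not_mem hj hk)]
    · push Not at h0
      obtain ⟨y, hy, hby⟩ := h0
      have hky : 0 < A k y := by
        by_contra hcon
        refine absurd (h y fun j hj => ?_) (not_le.2 hby)
        rcases Finset.mem_insert.1 hj with rfl | hj
        · exact not_lt.1 hcon
        · exact hy j hj
      -- Projecting along `y` onto the kernel of `A k` leaves one inequality fewer.
      obtain ⟨u, hu, hb⟩ := ih (fun j => A j - (A j y / A k y) • A k) (b - (b y / A k y) • A k)
        (fun x hx => by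
          have h1 := h (x - (A k x / A k y) • y) (fun j hj => by
            rcases Finset.mem_insert.1 hj with rfl | hj
            · simp [hky.ne']
            · have := hx j hj
              simp only [LinearMap.sub_apply, LinearMap.smul_apply, smul_eq_mul, map_sub,
                map_smul] at this ⊢
              calc A j x - A k x / A k y * A j y = A j x - A j y / A k y * A k x := by ring
                _ ≤ 0 := this)
          simp only [LinearMap.sub_apply, LinearMap.smul_apply, smul_eq_mul, map_sub,
            map_smul] at h1 ⊢
          calc b x - b y / A k y * A k x = b x - A k x / A k y * b y := by ring
            _ ≤ 0 := h1)
      have hsum : 0 ≤ b y / A k y - ∑ j ∈ s, u j * (A j y / A k y) := by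
        have h2 : ∑ j ∈ s, u j * (A j y / A k y) ≤ 0 :=
          Finset.sum_nonpos fun j hj =>
            mul_nonpos_of_nonneg_of_nonpos (hu j) (div_nonpos_of_nonpos_of_nonneg (hy j hj) hky.le)
        have h3 := div_pos hby hky
        linarith
      refine ⟨Function.update u k (b y / A k y - ∑ j ∈ s, u j * (A j y / A k y)), fun j => ?_, ?_⟩
      · by_cases hj : j = k
        · subst hj; simpa using hsum
        · simpa [hj] using hu j
      · rw [Finset.sum_insert hk, Function.update_self]
        have h4 : ∑ j ∈ s, Function.update u k (b y / A k y - ∑ j ∈ s, u j * (A j y / A k y)) j • A j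
            = ∑ j ∈ s, u j • A j :=
          Finset.sum_congr rfl fun j hj => by
            rw [Function.update_of_ne (ne_of_mem_of_not_mem hj hk)]
        rw [h4]
        ext x
        have h5 := congrArg (fun f : W →ₗ[F] F => f x) hb
        simp only [LinearMap.sub_apply, LinearMap.smul_apply, smul_eq_mul, LinearMap.sum_apply,
          LinearMap.add_apply, mul_sub, Finset.sum_sub_distrib, sub_mul, Finset.sum_mul] at h5 ⊢
        have h6 : ∑ j ∈ s, u j * (A j y / A k y * A k x) = ∑ j ∈ s, u j * (A j y / A k y) * A k x :=
          Finset.sum_congr rfl fun j _ => by ring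
        rw [h6] at h5
        linarith

/-- A rational vector has an integral positive multiple. -/
theorem exists_pos_nat_mul_eq_intCast {ι : Type*} [Finite ι] (u : ι → ℚ) :
    ∃ N : ℕ, 0 < N ∧ ∃ z : ι → ℤ, ∀ i, (N : ℚ) * u i = z i := by
  have := Fintype.ofFinite ι
  classical
  refine ⟨∏ i, (u i).den, Finset.prod_pos fun i _ => (u i).pos,
    fun i => (∏ j ∈ Finset.univ.erase i, (u j).den : ℕ) * (u i).num, fun i => ?_⟩
  rw [← Finset.mul_prod_erase _ _ (Finset.mem_univ i)]
  push_cast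
  rw [mul_right_comm, mul_comm ((u i).den : ℚ), Rat.mul_den_eq_num, mul_comm]

namespace TorusRep

noncomputable section

/-! ### Weights of monomials -/

section Weights

variable {ι : Type*} [Fintype ι] {r : ℕ}

/-- The weight `∑ aᵢ χᵢ` of the monomial `x ^ a`, where the coordinate `xᵢ` has weight `χᵢ`. -/
def weight (χ : ι → Fin r → ℤ) (a : ι →₀ ℕ) : Fin r → ℤ := ∑ i, a i • χ i

theorem weight_zero (χ : ι → Fin r → ℤ) : weight χ 0 = 0 := by simp [weight]

theorem weight_add (χ : ι → Fin r → ℤ) (a b : ι →₀ ℕ) :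
    weight χ (a + b) = weight χ a + weight χ b := by
  simp [weight, add_smul, Finset.sum_add_distrib]

theorem weight_sum (χ : ι → Fin r → ℤ) {κ : Type*} (s : Finset κ) (a : κ → ι →₀ ℕ) :
    weight χ (∑ k ∈ s, a k) = ∑ k ∈ s, weight χ (a k) := by
  classical
  induction s using Finset.induction_on with
  | empty => simp [weight_zero]
  | insert k s hk ih => rw [Finset.sum_insert hk, Finset.sum_insert hk, weight_add, ih]

/-- The combinatorial form of stability for a vector with support `S`: every coordinate `i` occurs
in a monomial of weight zero in the variables from `S ∪ {i}`. -/
def IsStableSupport (χ : ι → Fin r → ℤ) (S : Set ι) : Prop :=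
  ∀ i, ∃ a : ι →₀ ℕ, weight χ a = 0 ∧ a i ≠ 0 ∧ ∀ j, a j ≠ 0 → j ∈ S ∨ j = i

theorem IsStableSupport.mono {χ : ι → Fin r → ℤ} {S S' : Set ι} (h : S ⊆ S')
    (hS : IsStableSupport χ S) : IsStableSupport χ S' := fun i =>
  let ⟨a, h0, hi, ha⟩ := hS i
  ⟨a, h0, hi, fun j hj => (ha j hj).imp_left (@h j)⟩

/-- The integral form of Farkas' lemma: if no monomial of weight zero in the variables from `J`
contains `xᵢ`, a one-parameter subgroup has nonnegative weights on `J` and a positive one on `i`. -/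
theorem exists_cocharacter (χ : ι → Fin r → ℤ) (J : Set ι) (i : ι) (hi : i ∈ J)
    (h : ¬ ∃ a : ι →₀ ℕ, weight χ a = 0 ∧ a i ≠ 0 ∧ ∀ j, a j ≠ 0 → j ∈ J) :
    ∃ l : Fin r → ℤ, (∀ j ∈ J, 0 ≤ ∑ k, l k * χ j k) ∧ 0 < ∑ k, l k * χ i k := by
  classical
  by_contra hcon
  apply h
  let A : ι → (Fin r → ℚ) →ₗ[ℚ] ℚ := fun j => -∑ k, (χ j k : ℚ) • LinearMap.proj k
  have hA : ∀ j x, A j x = -∑ k, (χ j k : ℚ) * x k := fun j x => by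
    simp [A, LinearMap.sum_apply]
  obtain ⟨u, hu, hb⟩ := exists_nonneg_combination (Finset.univ.filter (· ∈ J)) A (-A i) (by
    intro x hx
    by_contra hpos
    apply hcon
    obtain ⟨N, hN, z, hz⟩ := exists_pos_nat_mul_eq_intCast x
    have key : ∀ j, ((∑ k, z k * χ j k : ℤ) : ℚ) = N * -A j x := fun j => by
      rw [hA, neg_neg, Finset.mul_sum]
      push_cast
      exact Finset.sum_congr rfl fun k _ => by rw [← hz]; ring
    have hN' : (0 : ℚ) < N := by exact_mod_cast hN
    refine ⟨z, fun j hj => ?_, ?_⟩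
    · have := hx j (by simpa using hj)
      have h2 : (0 : ℚ) ≤ ((∑ k, z k * χ j k : ℤ) : ℚ) := by
        rw [key]; exact mul_nonneg hN'.le (by linarith)
      exact_mod_cast h2
    · have h2 : (0 : ℚ) < ((∑ k, z k * χ i k : ℤ) : ℚ) := by
        rw [key]; exact mul_pos hN' (by simpa using hpos)
      exact_mod_cast h2)
  obtain ⟨N, hN, z, hz⟩ := exists_pos_nat_mul_eq_intCast u
  have hz0 : ∀ j, 0 ≤ z j := fun j => by
    have : (0 : ℚ) ≤ z j := by rw [← hz]; exact mul_nonneg (Nat.cast_nonneg _) (hu j)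
    exact_mod_cast this
  refine ⟨Finsupp.equivFunOnFinite.symm fun j =>
    (if j ∈ J then (z j).toNat else 0) + if j = i then N else 0, ?_, ?_, ?_⟩
  · ext k
    have h1 := congrArg (fun f : (Fin r → ℚ) →ₗ[ℚ] ℚ => f (Pi.single k 1)) hb
    simp only [LinearMap.neg_apply, LinearMap.sum_apply, LinearMap.smul_apply, hA,
      smul_eq_mul, Pi.single_apply, mul_ite, mul_one, mul_zero, Finset.sum_ite_eq',
      Finset.mem_univ, if_true, neg_neg] at h1
    have h2 : ((∑ j, (if j ∈ J then z j else 0) * χ j k + N * χ i k : ℤ) : ℚ) = 0 := by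
      push_cast
      rw [h1, Finset.mul_sum, Finset.sum_filter, ← Finset.sum_add_distrib]
      refine Finset.sum_eq_zero fun j _ => ?_
      split_ifs
      · rw [← hz]; ring
      · simp
    have h3 : (∑ j, (if j ∈ J then z j else 0) * χ j k + N * χ i k : ℤ) = 0 := by exact_mod_cast h2
    simp only [weight, Finset.sum_apply, Pi.smul_apply, Pi.zero_apply,
      Finsupp.equivFunOnFinite_symm_apply_apply]
    simp only [nsmul_eq_mul]
    rw [← h3]
    push_cast
    simp only [add_mul, Finset.sum_add_distrib]
    congr 1
    · refine Finset.sum_congr rfl fun j _ => ?_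
      split_ifs
      · rw [Int.toNat_of_nonneg (hz0 j)]
      · rfl
    · simp
  · simp only [Finsupp.equivFunOnFinite_symm_apply_apply, if_true]; omega
  · intro j hj
    by_contra hjJ
    have hji : j ≠ i := fun e => hjJ (e ▸ hi)
    simp [hjJ, hji] at hj

end Weights

/-! ### Characters and weight bases -/

section Characters

variable {K : Type*} [Field K] {r : ℕ}

/-- The character `t ↦ ∏ tᵢ ^ mᵢ` of the torus. -/
def character (m : Fin r → ℤ) : Torus K r →* Kˣ where
  toFun t := ∏ i, t i ^ m i
  map_one' := by simp
  map_mul' s t := by simp [mul_zpow, Finset.prod_mul_distrib]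

theorem character_apply (m : Fin r → ℤ) (t : Torus K r) : character m t = ∏ i, t i ^ m i := rfl

theorem character_zero (t : Torus K r) : character 0 t = 1 := by simp [character_apply]

theorem character_add (m n : Fin r → ℤ) (t : Torus K r) :
    character (m + n) t = character m t * character n t := by
  simp [character_apply, zpow_add, Finset.prod_mul_distrib]

theorem character_nsmul (k : ℕ) (m : Fin r → ℤ) (t : Torus K r) :
    character (k • m) t = character m t ^ k := by
  induction k with
  | zero => simp [character_zero]
  | succ k ih => rw [succ_nsmul, character_add, ih, pow_succ]

theorem character_weight {ι : Type*} [Fintype ι] (χ : ι → Fin r → ℤ) (a : ι →₀ ℕ)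
    (t : Torus K r) : character (weight χ a) t = ∏ i, character (χ i) t ^ a i := by
  classical
  unfold weight
  have : ∀ s : Finset ι, character (∑ i ∈ s, a i • χ i) t = ∏ i ∈ s, character (χ i) t ^ a i := by
    intro s
    induction s using Finset.induction_on with
    | empty => simp [character_zero]
    | insert k s hk ih =>
      rw [Finset.sum_insert hk, Finset.prod_insert hk, character_add, ih, character_nsmul]
  exact this _

theorem character_injective [CharZero K] :
    Function.Injective (character : (Fin r → ℤ) → Torus K r →* Kˣ) := by
  classical
  intro m n h
  ext i
  have h2 : (2 : K) ≠ 0 := two_ne_zero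
  have key : ∀ m : Fin r → ℤ,
      ((character m (Pi.mulSingle i (Units.mk0 2 h2)) : Kˣ) : K) = ((2 : ℚ) ^ m i : ℚ) := by
    intro m
    rw [character_apply, Finset.prod_eq_single i (fun j _ hj => by simp [hj]) (by simp)]
    simp
  have h1 := key m
  rw [h, key n] at h1
  exact (zpow_right_injective₀ (by norm_num : (0 : ℚ) < 2) (by norm_num) (Rat.cast_injective h1)).symm

variable {V : Type*} [AddCommGroup V] [Module K V] {ι : Type*}

/-- `b` is a basis of weight vectors; the torus acts on `b i` by the character `χ i`. -/
def IsWeightBasis (ρ : Representation K (Torus K r) V) (b : Module.Basis ι K V)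
    (χ : ι → Fin r → ℤ) : Prop :=
  ∀ t i, ρ t (b i) = ((character (χ i) t : Kˣ) : K) • b i

theorem IsWeightBasis.repr_apply {ρ : Representation K (Torus K r) V} {b : Module.Basis ι K V}
    {χ : ι → Fin r → ℤ} (h : IsWeightBasis ρ b χ) (t : Torus K r) (v : V) (i : ι) :
    b.repr (ρ t v) i = ((character (χ i) t : Kˣ) : K) * b.repr v i := by
  classical
  have : (b.coord i) ∘ₗ ρ t = ((character (χ i) t : Kˣ) : K) • b.coord i := by
    refine b.ext fun j => ?_
    by_cases hj : j = i
    · subst hj; simp [h t j]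
    · simp [h t j, hj]
  exact congrArg (fun f : V →ₗ[K] K => f v) this

/-- In an algebraic representation of a torus the weight vectors span, by the linear independence
of characters. -/
theorem span_weightVectors [CharZero K] [FiniteDimensional K V]
    (ρ : Representation K (Torus K r) V) (hρ : IsAlgebraic ρ) :
    Submodule.span K {v : V | ∃ m : Fin r → ℤ, ∀ t, ρ t v = ((character m t : Kˣ) : K) • v} = ⊤ := by
  classical
  rw [eq_top_iff]
  intro v _
  let c := Module.finBasis K V
  choose P hP using fun i => hρ v (c.coord i)
  let s : Finset (Fin r → ℤ) := Finset.univ.biUnion fun i => (P i).support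
  let w : (Fin r → ℤ) → V := fun m => ∑ i, P i m • c i
  have hw : ∀ t, ρ t v = ∑ m ∈ s, ((character m t : Kˣ) : K) • w m := by
    intro t
    conv_lhs => rw [← c.sum_repr (ρ t v)]
    simp only [w, Finset.smul_sum]
    rw [Finset.sum_comm]
    refine Finset.sum_congr rfl fun i _ => ?_
    have h1 := hP i t
    simp only [Module.Basis.coord_apply] at h1
    rw [h1, Finsupp.sum_of_support_subset (s := s) _
      (Finset.subset_biUnion_of_mem (fun i => (P i).support) (Finset.mem_univ i)) _ (by simp),
      Finset.sum_smul]
    exact Finset.sum_congr rfl fun m _ => by rw [smul_smul, mul_comm, character_apply]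
  have hwt : ∀ m ∈ s, ∀ t, ρ t (w m) = ((character m t : Kˣ) : K) • w m := by
    intro m hm t
    rw [← sub_eq_zero]
    refine (Module.forall_dual_apply_eq_zero_iff K _).1 fun φ => ?_
    have hli := (linearIndependent_monoidHom (Torus K r) K).comp
      (fun m : Fin r → ℤ => (Units.coeHom K).comp (character m)) (fun m n hmn =>
        character_injective (K := K)
          (MonoidHom.ext fun t => Units.ext (DFunLike.congr_fun hmn t)))
    refine linearIndependent_iff'.1 hli s
      (fun m => φ (ρ t (w m) - ((character m t : Kˣ) : K) • w m)) ?_ m hm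
    ext x
    have h1 : ρ t (ρ x v) = ρ (t * x) v := by rw [map_mul]; rfl
    rw [hw x, hw (t * x), map_sum] at h1
    have h2 := congrArg φ h1
    simp only [map_sum, map_smul, map_mul, Units.val_mul, smul_eq_mul] at h2
    simp only [Finset.sum_apply, Pi.smul_apply, Function.comp_apply, smul_eq_mul, map_sub, map_smul,
      Pi.zero_apply, sub_mul, Finset.sum_sub_distrib, MonoidHom.comp_apply, Units.coeHom_apply]
    rw [sub_eq_zero]
    refine Eq.trans (Finset.sum_congr rfl fun m _ => mul_comm _ _) (h2.trans ?_)
    exact Finset.sum_congr rfl fun m _ => by ring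
  have h1 : v = ∑ m ∈ s, w m := by
    have := hw 1
    simpa using this
  rw [h1]
  exact Submodule.sum_mem _ fun m hm => Submodule.subset_span ⟨m, hwt m hm⟩

theorem exists_isWeightBasis [CharZero K] [FiniteDimensional K V]
    (ρ : Representation K (Torus K r) V) (hρ : IsAlgebraic ρ) :
    ∃ (n : ℕ) (b : Module.Basis (Fin n) K V) (χ : Fin n → Fin r → ℤ), IsWeightBasis ρ b χ := by
  let s : Set V := {v : V | ∃ m : Fin r → ℤ, ∀ t, ρ t v = ((character m t : Kˣ) : K) • v}
  have hs : ⊤ ≤ Submodule.span K s := (span_weightVectors ρ hρ).ge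
  have hb : ∀ x, Module.Basis.ofSpan hs x ∈ s := fun x => 
    Module.Basis.ofSpan_subset hs ⟨x, rfl⟩
  have : Finite ↑((linearIndepOn_empty K id).extend (Set.empty_subset s)) :=
    Module.Finite.finite_basis (Module.Basis.ofSpan hs)
  let e := Finite.equivFin ↑((linearIndepOn_empty K id).extend (Set.empty_subset s))
  choose m hm using hb
  refine ⟨_, (Module.Basis.ofSpan hs).reindex e, fun i => m (e.symm i), fun t i => ?_⟩
  rw [Module.Basis.reindex_apply]
  exact hm _ t

end Characters

/-! ### The coordinate ring in coordinates -/

section Coordinates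

variable {K : Type*} [Field K] {V : Type*} [AddCommGroup V] [Module K V]

theorem polyFun_ext {f g : polyFun K V} (h : ∀ v, (f : V → K) v = (g : V → K) v) : f = g :=
  Subtype.ext (funext h)

variable {ι : Type*} (b : Module.Basis ι K V)

/-- The polynomial function with coordinate expression `p`, as a map to functions on `V`. -/
def polyEval : MvPolynomial ι K →ₐ[K] (V → K) := MvPolynomial.aeval fun i v => b.repr v i

theorem polyEval_apply (p : MvPolynomial ι K) (v : V) :
    polyEval b p v = MvPolynomial.eval (b.repr v) p := by
  have : (Pi.evalAlgHom K (fun _ : V => K) v).comp (polyEval b) =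
      MvPolynomial.aeval (b.repr v) := by
    ext i
    simp [polyEval]
  exact DFunLike.congr_fun this p

theorem polyEval_mem (p : MvPolynomial ι K) : polyEval b p ∈ polyFun K V := by
  have h : (polyEval b).range ≤ polyFun K V := by
    rw [polyEval, ← Algebra.adjoin_range_eq_range_aeval]
    refine Algebra.adjoin_mono ?_
    rintro _ ⟨i, rfl⟩
    exact ⟨b.coord i, rfl⟩
  exact h ⟨p, rfl⟩

variable [Finite ι]

theorem exists_polyEval_eq {f : V → K} (hf : f ∈ polyFun K V) : ∃ p, polyEval b p = f := by
  have := Fintype.ofFinite ι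
  have h : polyFun K V ≤ (polyEval b).range := by
    refine Algebra.adjoin_le ?_
    rintro _ ⟨φ, rfl⟩
    refine ⟨∑ i, MvPolynomial.C (φ (b i)) * MvPolynomial.X i, ?_⟩
    ext v
    change polyEval b _ v = _
    rw [polyEval_apply]
    conv_rhs => rw [← b.sum_repr v]
    simp [mul_comm, -Module.Basis.sum_repr]
  exact h hf

theorem polyEval_injective [Infinite K] : Function.Injective (polyEval b) := by
  have := Fintype.ofFinite ι
  intro p q h
  refine MvPolynomial.funext fun x => ?_
  have := congrFun h (b.equivFun.symm x)
  rw [polyEval_apply, polyEval_apply] at this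
  have hx : (b.repr (b.equivFun.symm x) : ι → K) = x := by
    ext i
    rw [← b.equivFun_apply, LinearEquiv.apply_symm_apply]
  rwa [hx] at this

/-- A basis identifies the ring of polynomial functions with a polynomial ring. -/
def polyEquiv [Infinite K] : MvPolynomial ι K ≃ₐ[K] polyFun K V :=
  AlgEquiv.ofBijective ((polyEval b).codRestrict _ (polyEval_mem b))
    ⟨fun _ _ h => polyEval_injective b (congrArg Subtype.val h), fun f =>
      let ⟨p, hp⟩ := exists_polyEval_eq b f.2
      ⟨p, Subtype.ext hp⟩⟩

theorem polyEquiv_apply [Infinite K] (p : MvPolynomial ι K) (v : V) :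
    (polyEquiv b p : V → K) v = MvPolynomial.eval (b.repr v) p := polyEval_apply b p v

theorem eval_symm_apply [Infinite K] (f : polyFun K V) (v : V) :
    MvPolynomial.eval (b.repr v) ((polyEquiv b).symm f) = (f : V → K) v := by
  rw [← polyEquiv_apply, AlgEquiv.apply_symm_apply]

theorem isDomain_polyFun [Infinite K] [FiniteDimensional K V] : IsDomain (polyFun K V) :=
  (polyEquiv (Module.finBasis K V)).symm.toMulEquiv.isDomain _

theorem uniqueFactorizationMonoid_polyFun [Infinite K] [FiniteDimensional K V] :
    UniqueFactorizationMonoid (polyFun K V) :=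
  (polyEquiv (Module.finBasis K V)).toMulEquiv.uniqueFactorizationMonoid inferInstance

theorem isNoetherianRing_polyFun [Infinite K] [FiniteDimensional K V] :
    IsNoetherianRing (polyFun K V) :=
  isNoetherianRing_of_ringEquiv _ (polyEquiv (Module.finBasis K V)).toRingEquiv

end Coordinates

/-! ### The Zariski topology -/

section Zariski

variable {K : Type*} [Field K] {V : Type*} [AddCommGroup V] [Module K V]

theorem isClosed_zariski_iff {Z : Set V} :
    @IsClosed V (zariski K V) Z ↔
      ∀ v, (∀ f : polyFun K V, (∀ w ∈ Z, (f : V → K) w = 0) → (f : V → K) v = 0) → v ∈ Z := by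
  have h : @IsClosed V (zariski K V) Z ↔
      ∃ S : Set (polyFun K V), Z = {v | ∀ f ∈ S, (f : V → K) v = 0} := by
    rw [← @isOpen_compl_iff V Z (zariski K V)]
    change Zᶜᶜ ∈ _ ↔ _
    rw [compl_compl]
    rfl
  rw [h]
  constructor
  · rintro ⟨S, rfl⟩ v hv f hf
    exact hv f fun w hw => hw f hf
  · intro hZ
    refine ⟨{f | ∀ w ∈ Z, (f : V → K) w = 0}, Set.Subset.antisymm (fun v hv f hf => hf v hv) hZ⟩

theorem isClosed_zeros (S : Set (polyFun K V)) :
    @IsClosed V (zariski K V) {v | ∀ f ∈ S, (f : V → K) v = 0} :=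
  isClosed_zariski_iff.2 fun _ hv f hf => hv f fun _ hw => hw f hf

theorem mem_closure_zariski_iff {S : Set V} {v : V} :
    v ∈ @closure V (zariski K V) S ↔
      ∀ f : polyFun K V, (∀ w ∈ S, (f : V → K) w = 0) → (f : V → K) v = 0 := by
  let := zariski K V
  constructor
  · intro hv f hf
    have : closure S ⊆ {v | ∀ g ∈ ({f} : Set (polyFun K V)), (g : V → K) v = 0} :=
      closure_minimal (fun w hw g hg => by rw [Set.mem_singleton_iff.1 hg]; exact hf w hw)
        (isClosed_zeros _)
    exact this hv f rfl
  · intro hv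
    exact isClosed_zariski_iff.1 isClosed_closure v fun f hf =>
      hv f fun w hw => hf w (subset_closure hw)

/-- A set is irreducible if and only if the ideal of the functions that vanish on it is prime. -/
theorem isIrreducible_zariski_iff {D : Set V} :
    @IsIrreducible V (zariski K V) D ↔ D.Nonempty ∧ ∀ f g : polyFun K V,
      (∀ v ∈ D, (f : V → K) v * (g : V → K) v = 0) →
        (∀ v ∈ D, (f : V → K) v = 0) ∨ ∀ v ∈ D, (g : V → K) v = 0 := by
  let := zariski K V
  refine and_congr_right fun _ => ?_
  rw [isPreirreducible_iff_isClosed_union_isClosed]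
  constructor
  · intro h f g hfg
    rcases h {v | ∀ k ∈ ({f} : Set (polyFun K V)), (k : V → K) v = 0}
      {v | ∀ k ∈ ({g} : Set (polyFun K V)), (k : V → K) v = 0} (isClosed_zeros _)
      (isClosed_zeros _) (fun v hv => by simpa [mul_eq_zero] using hfg v hv) with h | h
    · exact Or.inl fun v hv => h hv f rfl
    · exact Or.inr fun v hv => h hv g rfl
  · intro h Z Z' hZ hZ' hD
    by_contra hcon
    rw [not_or, Set.not_subset, Set.not_subset] at hcon
    obtain ⟨⟨v, hv, hvZ⟩, w, hw, hwZ⟩ := hcon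
    have h1 := mt (isClosed_zariski_iff.1 hZ v) hvZ
    have h2 := mt (isClosed_zariski_iff.1 hZ' w) hwZ
    push Not at h1 h2
    obtain ⟨f, hf, hfv⟩ := h1
    obtain ⟨g, hg, hgw⟩ := h2
    rcases h f g (fun u hu => by
      rcases hD hu with h | h
      · rw [hf u h, zero_mul]
      · rw [hg u h, mul_zero]) with h | h
    · exact hfv (h v hv)
    · exact hgw (h w hw)

theorem isIrreducible_univ_zariski [Infinite K] [FiniteDimensional K V] :
    @IsIrreducible V (zariski K V) Set.univ := by
  have := isDomain_polyFun (K := K) (V := V)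
  refine isIrreducible_zariski_iff.2 ⟨Set.univ_nonempty, fun f g h => ?_⟩
  have : f * g = 0 := polyFun_ext fun v => h v trivial
  rcases mul_eq_zero.1 this with rfl | rfl
  · exact Or.inl fun _ _ => rfl
  · exact Or.inr fun _ _ => rfl

end Zariski

/-! ### Invariants and weights -/

section Invariants

variable {K : Type*} [Field K] {r : ℕ} {V : Type*} [AddCommGroup V] [Module K V]
  {ι : Type*} [Fintype ι]

theorem coeff_aeval_C_mul_X (c : ι → K) (p : MvPolynomial ι K) (a : ι →₀ ℕ) :
    (MvPolynomial.aeval (fun i => MvPolynomial.C (c i) * MvPolynomial.X i) p :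
      MvPolynomial ι K).coeff a = (∏ i, c i ^ a i) * p.coeff a := by
  classical
  induction p using MvPolynomial.induction_on' with
  | monomial d k =>
    rw [MvPolynomial.aeval_monomial, Finsupp.prod_fintype _ _ (by simp)]
    have : (∏ i, (MvPolynomial.C (c i) * MvPolynomial.X i) ^ d i : MvPolynomial ι K) =
        MvPolynomial.monomial d (∏ i, c i ^ d i) := by
      rw [MvPolynomial.monomial_eq, Finsupp.prod_fintype _ _ (by simp)]
      simp [mul_pow, Finset.prod_mul_distrib]
    rw [this, MvPolynomial.algebraMap_eq, MvPolynomial.C_mul_monomial, MvPolynomial.coeff_monomial,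
      MvPolynomial.coeff_monomial]
    split_ifs with h
    · rw [h, mul_comm]
    · rw [mul_zero]
  | add p q hp hq => rw [map_add, MvPolynomial.coeff_add, hp, hq, MvPolynomial.coeff_add, mul_add]

variable [Infinite K] {ρ : Representation K (Torus K r) V} {b : Module.Basis ι K V}
  {χ : ι → Fin r → ℤ}

/-- A polynomial function is invariant if and only if all its monomials have weight zero. -/
theorem mem_invariants_iff [CharZero K] (hb : IsWeightBasis ρ b χ) (f : polyFun K V) :
    f ∈ invariants ρ ↔ ∀ a, ((polyEquiv b).symm f).coeff a ≠ 0 → weight χ a = 0 := by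
  set p := (polyEquiv b).symm f with hp
  have hact : ∀ t v, (f : V → K) (ρ t v) = MvPolynomial.eval (b.repr v)
      (MvPolynomial.aeval (fun i => MvPolynomial.C ((character (χ i) t : Kˣ) : K) *
        MvPolynomial.X i) p : MvPolynomial ι K) := by
    intro t v
    rw [← eval_symm_apply b f, ← hp]
    have : (MvPolynomial.aeval (b.repr (ρ t v)) : MvPolynomial ι K →ₐ[K] K) =
        (MvPolynomial.aeval (b.repr v)).comp (MvPolynomial.aeval (fun i =>
          MvPolynomial.C ((character (χ i) t : Kˣ) : K) * MvPolynomial.X i)) := by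
      ext i
      simp [hb.repr_apply]
    exact DFunLike.congr_fun this p
  constructor
  · intro hf a ha
    apply character_injective (K := K)
    refine MonoidHom.ext fun t => Units.ext ?_
    have h1 : (MvPolynomial.aeval (fun i => MvPolynomial.C ((character (χ i) t : Kˣ) : K) *
        MvPolynomial.X i) p : MvPolynomial ι K) = p := by
      apply (polyEquiv b).injective
      refine polyFun_ext fun v => ?_
      rw [polyEquiv_apply, ← hact, hf t v, polyEquiv_apply, hp, eval_symm_apply]
    have h2 := congrArg (MvPolynomial.coeff a) h1
    rw [coeff_aeval_C_mul_X] at h2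
    have h3 := mul_right_cancel₀ ha (h2.trans (one_mul _).symm)
    rw [character_weight, character_zero, Units.val_one, ← h3]
    push_cast
    rfl
  · intro h t v
    rw [hact, ← eval_symm_apply b f, ← hp]
    congr 1
    ext a
    rw [coeff_aeval_C_mul_X]
    by_cases ha : p.coeff a = 0
    · rw [ha, mul_zero]
    · have h1 := character_weight χ a t
      rw [h a ha, character_zero] at h1
      have h2 := congrArg Units.val h1
      push_cast at h2
      rw [← h2, one_mul]

variable (b) in
/-- The monomial `x ^ a` as a polynomial function. -/
def monomialFun (a : ι →₀ ℕ) : polyFun K V := polyEquiv b (MvPolynomial.monomial a 1)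

theorem monomialFun_apply (a : ι →₀ ℕ) (v : V) :
    (monomialFun b a : V → K) v = ∏ i, b.repr v i ^ a i := by
  rw [monomialFun, polyEquiv_apply, MvPolynomial.eval_monomial, one_mul,
    Finsupp.prod_fintype _ _ (by simp)]

theorem monomialFun_mem_invariants_iff [CharZero K] (hb : IsWeightBasis ρ b χ) (a : ι →₀ ℕ) :
    monomialFun b a ∈ invariants ρ ↔ weight χ a = 0 := by
  classical
  rw [mem_invariants_iff hb, monomialFun, AlgEquiv.symm_apply_apply]
  simp [MvPolynomial.coeff_monomial]

end Invariants

/-! ### Stable vectors -/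

section Stability

variable {K : Type*} [Field K] {r : ℕ} {V : Type*} [AddCommGroup V] [Module K V]
  {ι : Type*} [Fintype ι]
  {ρ : Representation K (Torus K r) V} {b : Module.Basis ι K V} {χ : ι → Fin r → ℤ}

theorem prod_zpow_eq_zpow_sum {G κ : Type*} [CommGroup G] (s : Finset κ) (g : G) (e : κ → ℤ) :
    ∏ k ∈ s, g ^ e k = g ^ ∑ k ∈ s, e k := by
  classical
  induction s using Finset.induction_on with
  | empty => simp
  | insert k s hk ih => rw [Finset.prod_insert hk, Finset.sum_insert hk, zpow_add, ih]

/-- The limit of `l(z) w` for `z → 0` along a one-parameter subgroup `l` lies in the closure of the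
orbit of `w`. -/
theorem mem_closure_orbit_of_cocharacter [Infinite K] (hb : IsWeightBasis ρ b χ) (l : Fin r → ℤ)
    {w v : V} (hl : ∀ j, b.repr w j ≠ 0 → 0 ≤ ∑ k, l k * χ j k)
    (hv : ∀ j, b.repr v j = if ∑ k, l k * χ j k = 0 then b.repr w j else 0) :
    v ∈ @closure V (zariski K V) (orbit ρ w) := by
  rw [mem_closure_zariski_iff]
  intro f hf
  set p := (polyEquiv b).symm f with hp
  let d : ι → ℕ := fun j => (∑ k, l k * χ j k).toNat
  -- `q z` is the value of `f` at `l(z) w`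
  let q : Polynomial K :=
    MvPolynomial.aeval (fun j => Polynomial.C (b.repr w j) * Polynomial.X ^ d j) p
  have hq : ∀ z, q.eval z = MvPolynomial.eval (fun j => b.repr w j * z ^ d j) p := by
    intro z
    have : ((Polynomial.aeval z).comp (MvPolynomial.aeval (fun j =>
        Polynomial.C (b.repr w j) * Polynomial.X ^ d j)) : MvPolynomial ι K →ₐ[K] K) =
        MvPolynomial.aeval (fun j => b.repr w j * z ^ d j) := by
      ext i; simp
    exact DFunLike.congr_fun this p
  have hq0 : q = 0 := by
    apply Polynomial.eq_zero_of_infinite_isRoot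
    refine Set.Infinite.mono (s := {0}ᶜ) ?_ (Set.finite_singleton 0).infinite_compl
    intro z hz
    let t : Torus K r := fun k => Units.mk0 z hz ^ l k
    have h1 : (f : V → K) (ρ t w) = 0 := hf _ ⟨t, rfl⟩
    rw [← eval_symm_apply b f, ← hp] at h1
    change q.eval z = 0
    rw [hq, ← h1]
    congr 1
    congr 1
    funext j
    rw [hb.repr_apply, mul_comm]
    by_cases hj : b.repr w j = 0
    · simp [hj]
    · congr 1
      have h2 : character (χ j) t = Units.mk0 z hz ^ ∑ k, l k * χ j k := by
        rw [character_apply]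
        simp only [t, ← zpow_mul]
        exact prod_zpow_eq_zpow_sum _ _ _
      have h4 : ∑ k, l k * χ j k = (d j : ℤ) := (Int.toNat_of_nonneg (hl j hj)).symm
      rw [h2, h4, zpow_natCast, Units.val_pow_eq_pow_val]
      rfl
  have h3 := hq 0
  rw [hq0, Polynomial.eval_zero] at h3
  rw [← eval_symm_apply b f, ← hp, h3]
  congr 2
  funext j
  rw [hv j]
  by_cases hj : b.repr w j = 0
  · simp [hj]
  · have := hl j hj
    by_cases h0 : ∑ k, l k * χ j k = 0
    · simp [d, h0]
    · have : d j ≠ 0 := by simp only [d]; omega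
      simp [h0, this]

theorem repr_ne_zero_iff_of_mem_orbit {ι : Type*} {b : Module.Basis ι K V}
    {χ : ι → Fin r → ℤ} (hb : IsWeightBasis ρ b χ) {v w : V} (h : w ∈ orbit ρ v)
    (i : ι) : b.repr w i ≠ 0 ↔ b.repr v i ≠ 0 := by
  obtain ⟨t, rfl⟩ := h
  rw [hb.repr_apply]
  simp

theorem mem_orbit_self (ρ : Representation K (Torus K r) V) (v : V) : v ∈ orbit ρ v :=
  ⟨1, by simp⟩

theorem orbit_eq_of_mem {v w : V} (h : w ∈ orbit ρ v) : orbit ρ w = orbit ρ v := by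
  obtain ⟨t, rfl⟩ := h
  ext u
  constructor
  · rintro ⟨s, rfl⟩
    exact ⟨s * t, by simp [map_mul]⟩
  · rintro ⟨s, rfl⟩
    exact ⟨s * t⁻¹, by simp [← Module.End.mul_apply, ← map_mul]⟩

/-- Otherwise a one-parameter subgroup moves `v`, or `v` enlarged by one coordinate, to a limit in
a different orbit. -/
theorem IsStableVector.isStableSupport [Infinite K] (hb : IsWeightBasis ρ b χ) {v : V}
    (hv : IsStableVector ρ v) : IsStableSupport χ {i | b.repr v i ≠ 0} := by
  classical
  by_contra hcon
  unfold IsStableSupport at hcon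
  push Not at hcon
  obtain ⟨i, hi⟩ := hcon
  obtain ⟨l, hl, hli⟩ := exists_cocharacter χ ({i | b.repr v i ≠ 0} ∪ {i}) i (by simp) (by
    rintro ⟨a, h0, hai, ha⟩
    obtain ⟨j, hj, hj1, hj2⟩ := hi a h0 hai
    rcases ha j hj with h | h
    · exact hj1 h
    · exact hj2 h)
  -- `w` is `v` with the `i`-th coordinate made nonzero
  let w : V := if b.repr v i = 0 then v + b i else v
  have hwi : b.repr w i ≠ 0 := by
    simp only [w]
    split_ifs with h
    · simp [h]
    · exact h
  have hwj : ∀ j, j ≠ i → b.repr w j = b.repr v j := by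
    intro j hj
    simp only [w]
    split_ifs with h
    · simp [hj.symm]
    · rfl
  let v' : V := b.equivFun.symm fun j => if ∑ k, l k * χ j k = 0 then b.repr w j else 0
  have hv' : ∀ j, b.repr v' j = if ∑ k, l k * χ j k = 0 then b.repr w j else 0 := by
    intro j
    rw [← b.equivFun_apply, LinearEquiv.apply_symm_apply]
  have hcl : v' ∈ @closure V (zariski K V) (orbit ρ w) := by
    refine mem_closure_orbit_of_cocharacter hb l (fun j hj => hl j ?_) hv'
    by_cases hji : j = i
    · exact Or.inr hji
    · exact Or.inl (by rwa [hwj j hji] at hj)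
  have hv'i : b.repr v' i = 0 := by rw [hv', if_neg hli.ne']
  by_cases hvi : b.repr v i = 0
  · by_cases hpos : ∀ j, b.repr v j ≠ 0 → ∑ k, l k * χ j k = 0
    · have hvv' : v' = v := by
        apply b.repr.injective
        ext j
        by_cases hj : j = i
        · rw [hj, hv'i, hvi]
        · rw [hv', hwj j hj]
          by_cases hvj : b.repr v j = 0
          · simp [hvj]
          · rw [if_pos (hpos j hvj)]
      refine hv.2 w (fun h => ?_) (hvv' ▸ hcl)
      exact (repr_ne_zero_iff_of_mem_orbit hb (h ▸ mem_orbit_self ρ w) i).1 hwi hvi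
    · push Not at hpos
      obtain ⟨j, hj, hjl⟩ := hpos
      let u : V := b.equivFun.symm fun j => if ∑ k, l k * χ j k = 0 then b.repr v j else 0
      have hu : ∀ j, b.repr u j = if ∑ k, l k * χ j k = 0 then b.repr v j else 0 := by
        intro j
        rw [← b.equivFun_apply, LinearEquiv.apply_symm_apply]
      have hmem := mem_closure_orbit_of_cocharacter hb l (fun j hj => hl j (Or.inl hj)) hu
      rw [@IsClosed.closure_eq V (zariski K V) _ hv.1] at hmem
      have := (repr_ne_zero_iff_of_mem_orbit hb hmem j).2 hj
      rw [hu, if_neg hjl] at this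
      exact this rfl
  · have hw : w = v := if_neg hvi
    rw [hw, @IsClosed.closure_eq V (zariski K V) _ hv.1] at hcl
    exact (repr_ne_zero_iff_of_mem_orbit hb hcl i).2 hvi hv'i

/-- Characters with prescribed values extend, by the divisibility of the multiplicative group: the
values `c i` are taken by the characters `χ i` at a common point of the torus as soon as they
satisfy all the multiplicative relations between these characters. -/
theorem exists_torus_point [IsAlgClosed K] (χ : ι → Fin r → ℤ) (c : ι → Kˣ)
    (h : ∀ z : ι → ℤ, ∑ i, z i • χ i = 0 → ∏ i, c i ^ z i = 1) :
    ∃ t : Torus K r, ∀ i, character (χ i) t = c i := by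
  classical
  let : DivisibleBy (Additive Kˣ) ℕ := divisibleByOfSMulRightSurj _ _ (by
    intro n hn x
    obtain ⟨z, hz⟩ := IsAlgClosed.exists_pow_nat_eq ((x.toMul : Kˣ) : K) (Nat.pos_of_ne_zero hn)
    have hz0 : z ≠ 0 := by
      rintro rfl
      rw [zero_pow hn] at hz
      exact x.toMul.ne_zero hz.symm
    exact ⟨Additive.ofMul (Units.mk0 z hz0), congrArg Additive.ofMul (Units.ext hz)⟩)
  let : DivisibleBy (Additive Kˣ) ℤ := AddGroup.divisibleByIntOfDivisibleByNat _
  let g : (ι → ℤ) →ₗ[ℤ] (Fin r → ℤ) := Fintype.linearCombination ℤ χ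
  let k : (ι → ℤ) →ₗ[ℤ] Additive Kˣ := Fintype.linearCombination ℤ fun i => Additive.ofMul (c i)
  have hgk : LinearMap.ker g ≤ LinearMap.ker k := by
    intro z hz
    have := h z hz
    rw [LinearMap.mem_ker, Fintype.linearCombination_apply]
    apply Additive.toMul.injective
    rw [toMul_sum]
    exact this
  obtain ⟨H, hH⟩ := (Module.Baer.of_divisible (Additive Kˣ)).extension_property
    ((LinearMap.ker g).liftQ g le_rfl) (by
      rw [← LinearMap.ker_eq_bot]; exact Submodule.ker_liftQ_eq_bot _ _ _ le_rfl)
    ((LinearMap.ker g).liftQ k hgk)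
  refine ⟨fun j => (H (Pi.single j 1)).toMul, fun i => ?_⟩
  have h1 : H (χ i) = Additive.ofMul (c i) := by
    have := LinearMap.congr_fun hH (Submodule.Quotient.mk (Pi.single i 1))
    simpa [g, k, Fintype.linearCombination_apply, Pi.single_apply] using this
  have h2 : χ i = ∑ j, χ i j • Pi.single j 1 := by
    ext j; simp [Pi.single_apply]
  have h3 := congrArg H h2
  rw [h1, map_sum] at h3
  have h4 := congrArg Additive.toMul h3
  rw [toMul_sum, toMul_ofMul] at h4
  rw [character_apply, h4]
  exact Finset.prod_congr rfl fun j _ => by rw [map_zsmul]; rfl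

/-- The fibre of the quotient map through a vector whose support satisfies the combinatorial
condition is a single orbit. -/
theorem mem_orbit_of_invariants_eq [IsAlgClosed K] [CharZero K] (hb : IsWeightBasis ρ b χ) {v w : V}
    (hv : IsStableSupport χ {i | b.repr v i ≠ 0})
    (h : ∀ f ∈ invariants ρ, (f : V → K) w = (f : V → K) v) : w ∈ orbit ρ v := by
  classical
  have hmon : ∀ a : ι →₀ ℕ, weight χ a = 0 →
      ∏ i, b.repr w i ^ a i = ∏ i, b.repr v i ^ a i := fun a ha => by
    rw [← monomialFun_apply, ← monomialFun_apply]
    exact h _ ((monomialFun_mem_invariants_iff hb a).2 ha)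
  choose a ha0 hai has using hv
  have hs : ∀ i, b.repr v i ≠ 0 → ∀ j, a i j ≠ 0 → b.repr v j ≠ 0 := fun i hi j hj => by
    rcases has i j hj with h | rfl
    exacts [h, hi]
  have hw1 : ∀ i, b.repr v i ≠ 0 → b.repr w i ≠ 0 := by
    intro i hi hwi
    have h1 := hmon (a i) (ha0 i)
    rw [Finset.prod_eq_zero (Finset.mem_univ i) (by rw [hwi, zero_pow (hai i)])] at h1
    refine Finset.prod_ne_zero_iff.2 (fun j _ => ?_) h1.symm
    by_cases hj : a i j = 0
    · simp [hj]
    · exact pow_ne_zero _ (hs i hi j hj)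
  have hw2 : ∀ i, b.repr v i = 0 → b.repr w i = 0 := by
    intro i hi
    by_contra hwi
    have h1 := hmon (a i) (ha0 i)
    rw [Finset.prod_eq_zero (f := fun j => b.repr v j ^ a i j) (Finset.mem_univ i)
      (by rw [hi, zero_pow (hai i)])] at h1
    refine Finset.prod_ne_zero_iff.2 (fun j _ => ?_) h1
    by_cases hj : a i j = 0
    · simp [hj]
    · rcases has i j hj with h | rfl
      exacts [pow_ne_zero _ (hw1 j h), pow_ne_zero _ hwi]
  let c : ι → Kˣ := fun i =>
    if hi : b.repr v i ≠ 0 then Units.mk0 _ (hw1 i hi) / Units.mk0 _ hi else 1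
  have hc1 : ∀ i, b.repr v i = 0 → c i = 1 := fun i hi => by simp [c, hi]
  have hc : ∀ i, (c i : K) * b.repr v i = b.repr w i := by
    intro i
    by_cases hi : b.repr v i = 0
    · rw [hi, hw2 i hi, mul_zero]
    · simp only [c, ne_eq, hi, not_false_eq_true, dite_true, Units.val_div_eq_div_val,
        Units.val_mk0]
      rw [div_mul_cancel₀ _ hi]
  have hcmon : ∀ d : ι →₀ ℕ, weight χ d = 0 → (∀ i, d i ≠ 0 → b.repr v i ≠ 0) →
      ∏ i, c i ^ d i = 1 := by
    intro d hd hds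
    have h1 := hmon d hd
    simp only [← hc, mul_pow, Finset.prod_mul_distrib] at h1
    have h2 : ∏ i, b.repr v i ^ d i ≠ 0 := Finset.prod_ne_zero_iff.2 fun i _ => by
      by_cases hi : d i = 0
      · simp [hi]
      · exact pow_ne_zero _ (hds i hi)
    have h3 := mul_right_cancel₀ h2 (h1.trans (one_mul _).symm)
    ext
    push_cast
    exact h3
  -- `A` is a relation that involves exactly the support of `v`
  let A : ι →₀ ℕ := ∑ i ∈ Finset.univ.filter (fun i => b.repr v i ≠ 0), a i
  have hA0 : weight χ A = 0 := by
    rw [weight_sum]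
    exact Finset.sum_eq_zero fun i _ => ha0 i
  have hAs : ∀ j, A j ≠ 0 → b.repr v j ≠ 0 := by
    intro j hj
    rw [Finsupp.finsetSum_apply] at hj
    obtain ⟨i, hi, hij⟩ := Finset.exists_ne_zero_of_sum_ne_zero hj
    exact hs i (Finset.mem_filter.1 hi).2 j hij
  have hApos : ∀ j, b.repr v j ≠ 0 → 1 ≤ A j := by
    intro j hj
    rw [Finsupp.finsetSum_apply]
    refine (Nat.one_le_iff_ne_zero.2 (hai j)).trans
      (Finset.single_le_sum (f := fun i => a i j) (fun _ _ => Nat.zero_le _) (by simpa using hj))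
  obtain ⟨t, ht⟩ := exists_torus_point (fun i => if b.repr v i ≠ 0 then χ i else 0) c (by
    intro z hz
    let N : ℕ := ∑ i, (z i).natAbs
    have hN : ∀ i, -z i ≤ N := fun i => by
      have h1 : (z i).natAbs ≤ N :=
        Finset.single_le_sum (f := fun i => (z i).natAbs) (fun _ _ => Nat.zero_le _)
          (Finset.mem_univ i)
      omega
    -- adding a multiple of `A` makes the exponents nonnegative
    let d : ι →₀ ℕ := Finsupp.equivFunOnFinite.symm fun i =>
      if b.repr v i ≠ 0 then (N * A i + z i).toNat else 0
    have hd : ∀ i, b.repr v i ≠ 0 → (d i : ℤ) = N * A i + z i := by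
      intro i hi
      simp only [d, Finsupp.equivFunOnFinite_symm_apply_apply, if_pos hi]
      apply Int.toNat_of_nonneg
      have h1 : (1 : ℤ) ≤ A i := by exact_mod_cast hApos i hi
      nlinarith [hN i, Int.natCast_nonneg N]
    have hd' : ∀ i, b.repr v i = 0 → d i = 0 := fun i hi => by simp [d, hi]
    have hd0 : weight χ d = 0 := by
      have h1 : weight χ d = (N : ℤ) • weight χ A +
          ∑ i, z i • (if b.repr v i ≠ 0 then χ i else 0) := by
        unfold weight
        rw [Finset.smul_sum, ← Finset.sum_add_distrib]
        refine Finset.sum_congr rfl fun i _ => ?_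
        by_cases hi : b.repr v i = 0
        · have : A i = 0 := by
            by_contra h
            exact hAs i h hi
          simp [hd' i hi, this, hi]
        · rw [if_pos hi, ← natCast_zsmul, hd i hi, add_smul, mul_smul, natCast_zsmul (χ i) (A i)]
      rw [h1, hA0, hz, smul_zero, add_zero]
    have h2 := hcmon d hd0 (fun i hi h => hi (hd' i h))
    have h3 := hcmon A hA0 hAs
    have h4 : ∏ i, c i ^ d i = (∏ i, c i ^ A i) ^ N * ∏ i, c i ^ z i := by
      rw [← Finset.prod_pow, ← Finset.prod_mul_distrib]
      refine Finset.prod_congr rfl fun i _ => ?_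
      by_cases hi : b.repr v i = 0
      · simp [hc1 i hi]
      · rw [← zpow_natCast, hd i hi, zpow_add, ← pow_mul, mul_comm (N : ℤ), zpow_mul, zpow_natCast,
          zpow_natCast, pow_mul]
    rw [h2, h3, one_pow, one_mul] at h4
    exact h4.symm)
  refine ⟨t, b.repr.injective ?_⟩
  ext i
  rw [hb.repr_apply]
  by_cases hi : b.repr v i = 0
  · rw [hi, hw2 i hi, mul_zero]
  · have h1 := ht i
    rw [if_pos hi] at h1
    rw [h1, hc]

theorem mem_closure_orbit_invariants {v w : V} (h : v ∈ @closure V (zariski K V) (orbit ρ w))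
    {f : polyFun K V} (hf : f ∈ invariants ρ) : (f : V → K) v = (f : V → K) w := by
  have h1 := mem_closure_zariski_iff.1 h (f - algebraMap K (polyFun K V) ((f : V → K) w)) (by
    rintro _ ⟨t, rfl⟩
    exact sub_eq_zero.2 (hf t w))
  exact sub_eq_zero.1 h1

/-- Stability depends on the support of a vector only. -/
theorem isStableVector_iff [IsAlgClosed K] [CharZero K] (hb : IsWeightBasis ρ b χ) (v : V) :
    IsStableVector ρ v ↔ IsStableSupport χ {i | b.repr v i ≠ 0} := by
  refine ⟨fun h => h.isStableSupport hb, fun h => ⟨?_, fun w hw hvw => ?_⟩⟩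
  · refine isClosed_zariski_iff.2 fun w hw => mem_orbit_of_invariants_eq hb h fun f hf => ?_
    exact mem_closure_orbit_invariants (mem_closure_zariski_iff.2 hw) hf
  · exact hw (orbit_eq_of_mem (mem_orbit_of_invariants_eq hb h fun f hf =>
      (mem_closure_orbit_invariants hvw hf).symm))

/-- The strictly semi-stable locus is a union of coordinate subspaces. -/
theorem isClosed_sss [IsAlgClosed K] [CharZero K] (hb : IsWeightBasis ρ b χ) :
    @IsClosed V (zariski K V) (sss ρ) := by
  let := zariski K V
  have h : sss ρ = ⋃ S : {S : Set ι // ¬ IsStableSupport χ S},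
      {v | ∀ f ∈ {f : polyFun K V | ∃ i ∉ S.1, f = monomialFun b (Finsupp.single i 1)},
        (f : V → K) v = 0} := by
    ext v
    simp only [sss, isStableVector_iff hb, Set.mem_ofPred_eq, Set.mem_iUnion]
    constructor
    · intro hv
      refine ⟨⟨_, hv⟩, ?_⟩
      rintro _ ⟨i, hi, rfl⟩
      simpa [monomialFun, polyEquiv_apply, MvPolynomial.eval_monomial] using hi
    · rintro ⟨⟨S, hS⟩, hv⟩ hstab
      refine hS (hstab.mono fun i hi => ?_)
      by_contra hiS
      apply hi
      simpa [monomialFun, polyEquiv_apply, MvPolynomial.eval_monomial] using hv _ ⟨i, hiS, rfl⟩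
  rw [h]
  exact isClosed_iUnion_of_finite fun S => isClosed_zeros _

end Stability

/-! ### Cofree representations -/

section Decomposition

variable {ι : Type*} [Fintype ι] {r : ℕ}

/-- The monomial `x ^ w` is reduced: it is not divisible by a nonconstant invariant monomial. -/
def IsReduced (χ : ι → Fin r → ℤ) (w : ι →₀ ℕ) : Prop :=
  ∀ l, weight χ l = 0 → l ≤ w → l = 0

theorem isReduced_zero (χ : ι → Fin r → ℤ) : IsReduced χ 0 := fun _ _ hl =>
  le_antisymm hl zero_le

/-- Every monomial has at most one decomposition as a product of an invariant monomial and a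
reduced one. -/
def HasUniqueDecomposition (χ : ι → Fin r → ℤ) : Prop :=
  ∀ l w l' w' : ι →₀ ℕ, weight χ l = 0 → IsReduced χ w → weight χ l' = 0 → IsReduced χ w' →
    l + w = l' + w' → w' = w

theorem exists_decomposition (χ : ι → Fin r → ℤ) (a : ι →₀ ℕ) :
    ∃ l w, weight χ l = 0 ∧ IsReduced χ w ∧ a = l + w := by
  induction a using WellFoundedLT.induction with
  | ind a ih =>
    by_cases ha : IsReduced χ a
    · exact ⟨0, a, weight_zero χ, ha, (zero_add a).symm⟩
    · unfold IsReduced at ha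
      push Not at ha
      obtain ⟨l, hl, hla, hl0⟩ := ha
      obtain ⟨m, rfl⟩ := exists_add_of_le hla
      obtain ⟨l', w, hl', hw, hm⟩ := ih m (lt_add_of_pos_left m (pos_iff_ne_zero.2 hl0))
      exact ⟨l + l', w, by rw [weight_add, hl, hl', add_zero], hw, by rw [hm, add_assoc]⟩

end Decomposition

theorem finsupp_map_apply {A κ κ' : Type*} [CommSemiring A] (p : (κ →₀ A) →ₗ[A] (κ' →₀ A))
    (n : κ →₀ A) (k : κ') : p n k = ∑ j ∈ n.support, n j * p (Finsupp.single j 1) k := by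
  conv_lhs => rw [← Finsupp.sum_single n, Finsupp.sum, map_sum, Finsupp.finsetSum_apply]
  refine Finset.sum_congr rfl fun j _ => ?_
  rw [← mul_one (n j), ← smul_eq_mul, ← Finsupp.smul_single, map_smul, Finsupp.smul_apply,
    smul_eq_mul, smul_eq_mul, mul_one]

section Cofree

variable {K : Type*} [Field K] [CharZero K] {r : ℕ} {V : Type*} [AddCommGroup V] [Module K V]
  {ι : Type*} [Fintype ι]
  (ρ : Representation K (Torus K r) V) (b : Module.Basis ι K V) (χ : ι → Fin r → ℤ)

-- Direct instances, since the search through the nested subalgebras is slow.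
instance : AddCommGroup (invariants ρ) := (Subalgebra.toCommRing (invariants ρ)).toAddCommGroup

instance : AddGroup (invariants ρ) := AddCommGroup.toAddGroup

/-- The `K[V]^T`-linear map from the free module on the reduced monomials to `K[V]`. -/
def reducedMap : ({w // IsReduced χ w} →₀ invariants ρ) →ₗ[invariants ρ] polyFun K V :=
  Finsupp.linearCombination (invariants ρ) fun w => monomialFun b w.1

variable {ρ b χ}

theorem reducedMap_apply (n : {w // IsReduced χ w} →₀ invariants ρ) :
    reducedMap ρ b χ n = ∑ w ∈ n.support, (n w : polyFun K V) * monomialFun b w.1 := rfl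

theorem monomialFun_add (a a' : ι →₀ ℕ) :
    (monomialFun b (a + a') : polyFun K V) = monomialFun b a * monomialFun b a' := by
  rw [monomialFun, monomialFun, monomialFun, ← map_mul, MvPolynomial.monomial_mul, one_mul]

theorem reducedMap_surjective (hb : IsWeightBasis ρ b χ) :
    Function.Surjective (reducedMap ρ b χ) := by
  rw [← LinearMap.range_eq_top, eq_top_iff]
  intro f _
  obtain ⟨p, rfl⟩ := (polyEquiv b).surjective f
  rw [p.as_sum, map_sum]
  refine Submodule.sum_mem _ fun a _ => ?_
  obtain ⟨l, w, hl, hw, rfl⟩ := exists_decomposition χ a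
  refine ⟨Finsupp.single ⟨w, hw⟩ (p.coeff (l + w) •
    ⟨monomialFun b l, (monomialFun_mem_invariants_iff hb l).2 hl⟩), ?_⟩
  rw [reducedMap, Finsupp.linearCombination_single]
  change (p.coeff (l + w) • monomialFun b l) * monomialFun b w = _
  rw [smul_mul_assoc, ← monomialFun_add, monomialFun, ← map_smul, MvPolynomial.smul_monomial,
    smul_eq_mul, mul_one]

/-- The coefficient of `reducedMap n` at `l + w` if this monomial decomposes in one way only. -/
theorem coeff_reducedMap (hb : IsWeightBasis ρ b χ) (n : {w // IsReduced χ w} →₀ invariants ρ)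
    (l : ι →₀ ℕ) (w : {w // IsReduced χ w})
    (h : ∀ l' w' : ι →₀ ℕ, weight χ l' = 0 → IsReduced χ w' → l + w.1 = l' + w' → w' = w.1) :
    ((polyEquiv b).symm (reducedMap ρ b χ n)).coeff (l + w.1) =
      ((polyEquiv b).symm (n w : polyFun K V)).coeff l := by
  classical
  rw [reducedMap_apply, map_sum, MvPolynomial.coeff_sum]
  simp only [map_mul, monomialFun, AlgEquiv.symm_apply_apply, MvPolynomial.coeff_mul_monomial',
    mul_one]
  rw [Finset.sum_eq_single w]
  · simp
  · intro w' _ hw'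
    split_ifs with hle
    · by_contra hne
      refine hw' (Subtype.ext (h _ _ ?_ w'.2 (tsub_add_cancel_of_le hle).symm))
      exact (mem_invariants_iff hb _).1 (n w').2 _ hne
    · rfl
  · intro hw
    rw [Finsupp.notMem_support_iff.1 hw]
    simp

theorem isCofree_of_hasUniqueDecomposition (hb : IsWeightBasis ρ b χ)
    (h : HasUniqueDecomposition χ) : IsCofree ρ := by
  have hinj : Function.Injective (reducedMap ρ b χ) := by
    refine (injective_iff_map_eq_zero (reducedMap ρ b χ)).2 fun n hn => ?_
    ext1 w
    apply Subtype.ext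
    apply (polyEquiv b).symm.injective
    ext l
    by_cases hl : weight χ l = 0
    · rw [← coeff_reducedMap hb n l w fun l' w' hl' hw' => h l w.1 l' w' hl w.2 hl' hw', hn]
      simp
    · have h1 := mt ((mem_invariants_iff hb _).1 (n w).2 l) hl
      rw [not_not] at h1
      rw [h1]
      simp
  exact Module.Free.of_equiv (LinearEquiv.ofBijective _ ⟨hinj, reducedMap_surjective hb⟩)

/-- If `K[V]` is projective over the invariants, the kernel `N` of `reducedMap` is a direct summand
of the free module with `N = I N` for the ideal `I` of the origin, so that `N = 0` by Krull's
intersection theorem. -/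
theorem reducedMap_injective [FiniteDimensional K V] (hb : IsWeightBasis ρ b χ)
    (h : Module.Projective (invariants ρ) (polyFun K V)) :
    Function.Injective (reducedMap ρ b χ) := by
  classical
  have := isDomain_polyFun (K := K) (V := V)
  have := isNoetherianRing_polyFun (K := K) (V := V)
  obtain ⟨s, hs⟩ := Module.projective_lifting_property (reducedMap ρ b χ) LinearMap.id
    (reducedMap_surjective hb)
  let ev : polyFun K V →ₐ[K] K :=
    (Pi.evalAlgHom K (fun _ : V => K) 0).comp (polyFun K V).val
  let I : Ideal (polyFun K V) := RingHom.ker ev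
  have hI : I ≠ ⊤ := RingHom.ker_ne_top _
  have hN : ∀ n, reducedMap ρ b χ n = 0 → ∀ w, (n w : polyFun K V) ∈ I := by
    intro n hn w
    have h1 := coeff_reducedMap hb n 0 w (fun l' w' hl' _ he => by
      rw [zero_add] at he
      have := w.2 l' hl' (he ▸ le_self_add)
      rw [he, this, zero_add])
    rw [hn, map_zero, MvPolynomial.coeff_zero] at h1
    change ((n w : polyFun K V) : V → K) 0 = 0
    rw [← eval_symm_apply b, map_zero, Finsupp.coe_zero, MvPolynomial.eval_zero,
      MvPolynomial.constantCoeff_eq, ← h1]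
  have hpow : ∀ k : ℕ, ∀ n, reducedMap ρ b χ n = 0 → ∀ w, (n w : polyFun K V) ∈ I ^ k := by
    intro k
    induction k with
    | zero => intro n _ w; simp
    | succ k ih =>
      intro n hn w
      let p : ({w // IsReduced χ w} →₀ invariants ρ) →ₗ[invariants ρ]
          ({w // IsReduced χ w} →₀ invariants ρ) := LinearMap.id - s ∘ₗ reducedMap ρ b χ
      have hp : ∀ m, reducedMap ρ b χ (p m) = 0 := fun m => by
        have := LinearMap.congr_fun hs (reducedMap ρ b χ m)
        simp only [LinearMap.comp_apply, LinearMap.id_apply] at this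
        simp [p, this]
      have hpn : p n = n := by simp [p, hn]
      have h2 : n w = ∑ w' ∈ n.support, n w' * p (Finsupp.single w' 1) w := by
        conv_lhs => rw [← hpn, finsupp_map_apply]
      rw [h2, AddSubmonoidClass.coe_finsetSum]
      refine Ideal.sum_mem _ fun w' _ => ?_
      rw [pow_succ', MulMemClass.coe_mul]
      exact Ideal.mul_mem_mul (hN n hn w') (ih _ (hp _) w)
  refine (injective_iff_map_eq_zero (reducedMap ρ b χ)).2 fun n hn => ?_
  ext1 w
  apply Subtype.ext
  have h3 : (n w : polyFun K V) ∈ ⨅ k : ℕ, I ^ k := (Ideal.mem_iInf).2 fun k => hpow k n hn w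
  rw [Ideal.iInf_pow_eq_bot_of_isDomain I hI] at h3
  exact h3

/-- `V` is cofree if and only if the reduced monomials form a basis of `K[V]` over the
invariants. -/
theorem isCofree_iff [FiniteDimensional K V] (hb : IsWeightBasis ρ b χ) :
    IsCofree ρ ↔ HasUniqueDecomposition χ := by
  classical
  refine ⟨fun h l w l' w' hl hw hl' hw' he => ?_, isCofree_of_hasUniqueDecomposition hb⟩
  have : Module.Free (invariants ρ) (polyFun K V) := h
  have hinj := reducedMap_injective hb (Module.Projective.of_free)
  by_contra hne
  have h1 := @hinj
    (Finsupp.single ⟨w, hw⟩ ⟨monomialFun b l, (monomialFun_mem_invariants_iff hb l).2 hl⟩)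
    (Finsupp.single ⟨w', hw'⟩ ⟨monomialFun b l', (monomialFun_mem_invariants_iff hb l').2 hl'⟩) (by
      rw [reducedMap, Finsupp.linearCombination_single, Finsupp.linearCombination_single]
      change monomialFun b l * monomialFun b w = monomialFun b l' * monomialFun b w'
      rw [← monomialFun_add, ← monomialFun_add, he])
  have h2 := congrArg (fun n => ((n ⟨w, hw⟩ : invariants ρ) : polyFun K V)) h1
  simp only [Finsupp.single_eq_same] at h2
  rw [Finsupp.single_eq_of_ne (by simpa [eq_comm] using hne)] at h2
  change polyEquiv b _ = 0 at h2
  rw [map_eq_zero_iff _ (polyEquiv b).injective, MvPolynomial.monomial_eq_zero] at h2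
  exact one_ne_zero h2

end Cofree

/-! ### Weights of a direct sum -/

section SumElim

variable {ι₁ ι₂ : Type*}

theorem sumElim_le_iff {a₁ a₁' : ι₁ →₀ ℕ} {a₂ a₂' : ι₂ →₀ ℕ} :
    a₁.sumElim a₂ ≤ a₁'.sumElim a₂' ↔ a₁ ≤ a₁' ∧ a₂ ≤ a₂' := by
  simp [Finsupp.le_def]

theorem sumElim_inj {a₁ a₁' : ι₁ →₀ ℕ} {a₂ a₂' : ι₂ →₀ ℕ} :
    a₁.sumElim a₂ = a₁'.sumElim a₂' ↔ a₁ = a₁' ∧ a₂ = a₂' := by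
  simp [Finsupp.ext_iff]

theorem sumElim_add (a₁ a₁' : ι₁ →₀ ℕ) (a₂ a₂' : ι₂ →₀ ℕ) :
    a₁.sumElim a₂ + a₁'.sumElim a₂' = (a₁ + a₁').sumElim (a₂ + a₂') := by
  ext (i | i) <;> simp

theorem sumElim_zero : (0 : ι₁ →₀ ℕ).sumElim (0 : ι₂ →₀ ℕ) = 0 := by
  ext (i | i) <;> simp

end SumElim

section Split

variable {ι₁ ι₂ : Type*} [Fintype ι₁] [Fintype ι₂] {r : ℕ}
  {χ₁ : ι₁ → Fin r → ℤ} {χ₂ : ι₂ → Fin r → ℤ}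

theorem weight_sumElim (a₁ : ι₁ →₀ ℕ) (a₂ : ι₂ →₀ ℕ) :
    weight (Sum.elim χ₁ χ₂) (a₁.sumElim a₂) = weight χ₁ a₁ + weight χ₂ a₂ := by
  simp [weight, Fintype.sum_sum_type]

variable (χ₁ χ₂) in
/-- Both factors of an invariant monomial `x ^ a₁ y ^ a₂` are invariant. -/
def WeightsSplit : Prop :=
  ∀ (a₁ : ι₁ →₀ ℕ) (a₂ : ι₂ →₀ ℕ), weight χ₁ a₁ + weight χ₂ a₂ = 0 →
    weight χ₁ a₁ = 0 ∧ weight χ₂ a₂ = 0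

theorem exists_eq_sumElim (a : ι₁ ⊕ ι₂ →₀ ℕ) :
    ∃ (a₁ : ι₁ →₀ ℕ) (a₂ : ι₂ →₀ ℕ), a = a₁.sumElim a₂ := by
  refine ⟨Finsupp.equivFunOnFinite.symm (fun i => a (Sum.inl i)),
    Finsupp.equivFunOnFinite.symm (fun i => a (Sum.inr i)), ?_⟩
  ext (i | i) <;> simp

theorem WeightsSplit.weight_eq_zero_iff (h : WeightsSplit χ₁ χ₂) (a₁ : ι₁ →₀ ℕ) (a₂ : ι₂ →₀ ℕ) :
    weight (Sum.elim χ₁ χ₂) (a₁.sumElim a₂) = 0 ↔ weight χ₁ a₁ = 0 ∧ weight χ₂ a₂ = 0 := by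
  rw [weight_sumElim]
  exact ⟨h a₁ a₂, fun ⟨h1, h2⟩ => by rw [h1, h2, add_zero]⟩

theorem WeightsSplit.isReduced_iff (h : WeightsSplit χ₁ χ₂) (w₁ : ι₁ →₀ ℕ) (w₂ : ι₂ →₀ ℕ) :
    IsReduced (Sum.elim χ₁ χ₂) (w₁.sumElim w₂) ↔ IsReduced χ₁ w₁ ∧ IsReduced χ₂ w₂ := by
  constructor
  · intro hw
    refine ⟨fun l hl hlw => ?_, fun l hl hlw => ?_⟩
    · have := hw (l.sumElim 0) ((h.weight_eq_zero_iff _ _).2 ⟨hl, weight_zero _⟩)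
        (sumElim_le_iff.2 ⟨hlw, zero_le⟩)
      rw [← sumElim_zero, sumElim_inj] at this
      exact this.1
    · have := hw (Finsupp.sumElim 0 l) ((h.weight_eq_zero_iff _ _).2 ⟨weight_zero _, hl⟩)
        (sumElim_le_iff.2 ⟨zero_le, hlw⟩)
      rw [← sumElim_zero, sumElim_inj] at this
      exact this.2
  · rintro ⟨h1, h2⟩ l hl hlw
    obtain ⟨l₁, l₂, rfl⟩ := exists_eq_sumElim l
    rw [h.weight_eq_zero_iff] at hl
    rw [sumElim_le_iff] at hlw
    rw [h1 l₁ hl.1 hlw.1, h2 l₂ hl.2 hlw.2, sumElim_zero]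

theorem WeightsSplit.hasUniqueDecomposition_iff (h : WeightsSplit χ₁ χ₂) :
    HasUniqueDecomposition (Sum.elim χ₁ χ₂) ↔
      HasUniqueDecomposition χ₁ ∧ HasUniqueDecomposition χ₂ := by
  constructor
  · intro hU
    refine ⟨fun l w l' w' hl hw hl' hw' he => ?_, fun l w l' w' hl hw hl' hw' he => ?_⟩
    · have := hU (l.sumElim 0) (w.sumElim 0) (l'.sumElim 0) (w'.sumElim 0)
        ((h.weight_eq_zero_iff _ _).2 ⟨hl, weight_zero _⟩)
        ((h.isReduced_iff _ _).2 ⟨hw, isReduced_zero _⟩)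
        ((h.weight_eq_zero_iff _ _).2 ⟨hl', weight_zero _⟩)
        ((h.isReduced_iff _ _).2 ⟨hw', isReduced_zero _⟩) (by rw [sumElim_add, sumElim_add, he])
      exact (sumElim_inj.1 this).1
    · have := hU (Finsupp.sumElim 0 l) (Finsupp.sumElim 0 w) (Finsupp.sumElim 0 l')
        (Finsupp.sumElim 0 w')
        ((h.weight_eq_zero_iff _ _).2 ⟨weight_zero _, hl⟩)
        ((h.isReduced_iff _ _).2 ⟨isReduced_zero _, hw⟩)
        ((h.weight_eq_zero_iff _ _).2 ⟨weight_zero _, hl'⟩)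
        ((h.isReduced_iff _ _).2 ⟨isReduced_zero _, hw'⟩) (by rw [sumElim_add, sumElim_add, he])
      exact (sumElim_inj.1 this).2
  · rintro ⟨h1, h2⟩ l w l' w' hl hw hl' hw' he
    obtain ⟨l₁, l₂, rfl⟩ := exists_eq_sumElim l
    obtain ⟨w₁, w₂, rfl⟩ := exists_eq_sumElim w
    obtain ⟨l₁', l₂', rfl⟩ := exists_eq_sumElim l'
    obtain ⟨w₁', w₂', rfl⟩ := exists_eq_sumElim w'
    rw [h.weight_eq_zero_iff] at hl hl'
    rw [h.isReduced_iff] at hw hw'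
    rw [sumElim_add, sumElim_add, sumElim_inj] at he
    exact sumElim_inj.2 ⟨h1 _ _ _ _ hl.1 hw.1 hl'.1 hw'.1 he.1,
      h2 _ _ _ _ hl.2 hw.2 hl'.2 hw'.2 he.2⟩

theorem WeightsSplit.isStableSupport_iff (h : WeightsSplit χ₁ χ₂) (S : Set (ι₁ ⊕ ι₂)) :
    IsStableSupport (Sum.elim χ₁ χ₂) S ↔
      IsStableSupport χ₁ (Sum.inl ⁻¹' S) ∧ IsStableSupport χ₂ (Sum.inr ⁻¹' S) := by
  constructor
  · intro hS
    refine ⟨fun i => ?_, fun i => ?_⟩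
    · obtain ⟨a, h0, hi, ha⟩ := hS (Sum.inl i)
      obtain ⟨a₁, a₂, rfl⟩ := exists_eq_sumElim a
      exact ⟨a₁, ((h.weight_eq_zero_iff _ _).1 h0).1, hi, fun j hj => by
        simpa using ha (Sum.inl j) hj⟩
    · obtain ⟨a, h0, hi, ha⟩ := hS (Sum.inr i)
      obtain ⟨a₁, a₂, rfl⟩ := exists_eq_sumElim a
      exact ⟨a₂, ((h.weight_eq_zero_iff _ _).1 h0).2, hi, fun j hj => by
        simpa using ha (Sum.inr j) hj⟩
  · rintro ⟨h1, h2⟩ (i | i)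
    · obtain ⟨a, h0, hi, ha⟩ := h1 i
      refine ⟨a.sumElim 0, (h.weight_eq_zero_iff _ _).2 ⟨h0, weight_zero _⟩, hi, ?_⟩
      rintro (j | j) hj
      · simpa using ha j hj
      · simp at hj
    · obtain ⟨a, h0, hi, ha⟩ := h2 i
      refine ⟨Finsupp.sumElim 0 a, (h.weight_eq_zero_iff _ _).2 ⟨weight_zero _, h0⟩, hi, ?_⟩
      rintro (j | j) hj
      · simp at hj
      · simpa using ha j hj

end Split

/-! ### Ideals of functions vanishing on a set -/

section VanishingFunctions

variable {K : Type*} [Field K] {A B C : Type*} [CommRing A] [Algebra K A] [CommRing B] [Algebra K B]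
  [CommRing C] [Algebra K C] {X Y Z : Type*}

/-- The ideal of the elements of `A` that vanish on `D`, where `A` acts as a ring of `K`-valued
functions through `α`. -/
def vanishing (α : A →ₐ[K] (X → K)) (D : Set X) : Ideal A where
  carrier := {a | ∀ x ∈ D, α a x = 0}
  add_mem' := fun {a b} ha hb x hx => by rw [map_add, Pi.add_apply, ha x hx, hb x hx, add_zero]
  zero_mem' := fun x _ => by rw [map_zero, Pi.zero_apply]
  smul_mem' := fun c a ha x hx => by
    rw [smul_eq_mul, map_mul, Pi.mul_apply, ha x hx, mul_zero]

/-- The set `Z` is the product of `X` and `Y`, and the ring of functions `C` on `Z` is generated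
by the rings of functions `A` on `X` and `B` on `Y`. -/
structure IsProductOf (α : A →ₐ[K] (X → K)) (β : B →ₐ[K] (Y → K)) (γ : C →ₐ[K] (Z → K))
    (p : Z → X) (q : Z → Y) (μ : A ⊗[K] B →ₐ[K] C) : Prop where
  injective_left : Function.Injective α
  injective_right : Function.Injective β
  injective : Function.Injective γ
  surjective : Function.Surjective μ
  apply_tmul : ∀ a b z, γ (μ (a ⊗ₜ b)) z = α a (p z) * β b (q z)
  exists_point : ∀ x y, ∃ z, p z = x ∧ q z = y

namespace IsProductOf

variable {α : A →ₐ[K] (X → K)} {β : B →ₐ[K] (Y → K)} {γ : C →ₐ[K] (Z → K)}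
    {p : Z → X} {q : Z → Y} {μ : A ⊗[K] B →ₐ[K] C}

theorem exists_slice (h : IsProductOf α β γ p q μ) (c : C) (y : Y) :
    ∃ a, ∀ z, q z = y → γ c z = α a (p z) := by
  obtain ⟨t, rfl⟩ := h.surjective c
  induction t with
  | zero => exact ⟨0, fun z _ => by simp⟩
  | tmul a b =>
    refine ⟨β b y • a, fun z hz => ?_⟩
    rw [h.apply_tmul, hz, map_smul, Pi.smul_apply, smul_eq_mul, mul_comm]
  | add s t hs ht =>
    obtain ⟨a, ha⟩ := hs
    obtain ⟨a', ha'⟩ := ht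
    exact ⟨a + a', fun z hz => by
      rw [map_add, map_add, map_add, Pi.add_apply, Pi.add_apply, ha z hz, ha' z hz]⟩

/-- A function on the product that vanishes on the preimage of `D ⊆ X` is a combination of
functions from `X` that vanish on `D`, with a basis of `B` as coefficients. -/
theorem exists_expansion (h : IsProductOf α β γ p q μ) {D : Set X} {c : C}
    (hc : c ∈ vanishing γ (p ⁻¹' D)) :
    ∃ (s : Finset (Module.Basis.ofVectorSpaceIndex K B))
      (a : Module.Basis.ofVectorSpaceIndex K B → A), (∀ k, a k ∈ vanishing α D) ∧
        c = ∑ k ∈ s, μ (a k ⊗ₜ Module.Basis.ofVectorSpace K B k) := by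
  obtain ⟨t, rfl⟩ := h.surjective c
  let 𝓑 := Module.Basis.ofVectorSpace K B
  obtain ⟨a, rfl⟩ := TensorProduct.eq_repr_basis_right 𝓑 t
  refine ⟨a.support, a, fun k x hx => ?_, by rw [Finsupp.sum, map_sum]⟩
  have h1 : ∑ k ∈ a.support, α (a k) x • 𝓑 k = 0 := by
    apply h.injective_right
    rw [map_zero]
    ext y
    obtain ⟨z, hz, rfl⟩ := h.exists_point x y
    have h2 := hc z (show p z ∈ D from hz.symm ▸ hx)
    rw [Finsupp.sum, map_sum, map_sum, Finset.sum_apply] at h2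
    rw [map_sum, Finset.sum_apply, Pi.zero_apply, ← h2]
    refine Finset.sum_congr rfl fun k _ => ?_
    rw [map_smul, Pi.smul_apply, smul_eq_mul, h.apply_tmul, hz]
  by_cases hk : k ∈ a.support
  · exact linearIndependent_iff'.1 𝓑.linearIndependent _ _ h1 k hk
  · rw [Finsupp.notMem_support_iff.1 hk, map_zero, Pi.zero_apply]

theorem apply_tmul_one (h : IsProductOf α β γ p q μ) (a : A) (z : Z) :
    γ (μ (a ⊗ₜ 1)) z = α a (p z) := by
  rw [h.apply_tmul, map_one, Pi.one_apply, mul_one]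

theorem vanishing_eq_bot_iff [Nonempty Y] (h : IsProductOf α β γ p q μ) (D : Set X) :
    vanishing γ (p ⁻¹' D) = ⊥ ↔ vanishing α D = ⊥ := by
  constructor
  · intro h0
    rw [eq_bot_iff]
    intro a ha
    have h1 : μ (a ⊗ₜ 1) ∈ vanishing γ (p ⁻¹' D) := fun z hz => by
      rw [h.apply_tmul_one]
      exact ha _ hz
    rw [h0, Ideal.mem_bot] at h1
    apply h.injective_left
    rw [map_zero]
    ext x
    obtain ⟨z, rfl, -⟩ := h.exists_point x (Classical.arbitrary Y)
    rw [← h.apply_tmul_one, h1, map_zero, Pi.zero_apply, Pi.zero_apply]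
  · intro h0
    rw [eq_bot_iff]
    intro c hc
    obtain ⟨s, a, ha, rfl⟩ := h.exists_expansion hc
    refine Ideal.sum_mem _ fun k _ => ?_
    have := ha k
    rw [h0, Ideal.mem_bot] at this
    rw [this, TensorProduct.zero_tmul, map_zero]
    exact Ideal.zero_mem _

/-- Extension of ideals to the product preserves generators, and restriction to a slice takes
a generator to a generator. -/
theorem isPrincipal_vanishing_iff [Nonempty Y] (h : IsProductOf α β γ p q μ) (D : Set X) :
    (vanishing γ (p ⁻¹' D)).IsPrincipal ↔ (vanishing α D).IsPrincipal := by
  constructor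
  · rintro ⟨g, hg⟩
    let y : Y := Classical.arbitrary Y
    obtain ⟨f, hf⟩ := h.exists_slice g y
    have hgmem : g ∈ vanishing γ (p ⁻¹' D) := hg ▸ Ideal.mem_span_singleton_self g
    refine ⟨f, le_antisymm (fun a ha => ?_) ?_⟩
    · have h1 : μ (a ⊗ₜ 1) ∈ vanishing γ (p ⁻¹' D) := fun z hz => by
        rw [h.apply_tmul_one]
        exact ha _ hz
      rw [hg] at h1
      obtain ⟨k, hk⟩ := Ideal.mem_span_singleton'.1 h1
      obtain ⟨k', hk'⟩ := h.exists_slice k y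
      refine Ideal.mem_span_singleton'.2 ⟨k', h.injective_left ?_⟩
      ext x
      obtain ⟨z, rfl, hz⟩ := h.exists_point x y
      rw [← h.apply_tmul_one a, ← hk, map_mul, map_mul, Pi.mul_apply, Pi.mul_apply, hf z hz,
        hk' z hz]
    · refine (Ideal.span_singleton_le_iff_mem _).2 fun x hx => ?_
      obtain ⟨z, rfl, hz⟩ := h.exists_point x y
      rw [← hf z hz]
      exact hgmem z hx
  · rintro ⟨f, hf⟩
    refine ⟨μ (f ⊗ₜ 1), le_antisymm (fun c hc => ?_) ?_⟩
    · obtain ⟨s, a, ha, rfl⟩ := h.exists_expansion hc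
      refine Ideal.sum_mem _ fun k _ => ?_
      have := ha k
      rw [hf] at this
      obtain ⟨a', ha'⟩ := Ideal.mem_span_singleton'.1 this
      refine Ideal.mem_span_singleton'.2 ⟨μ (a' ⊗ₜ Module.Basis.ofVectorSpace K B k), ?_⟩
      rw [← map_mul, Algebra.TensorProduct.tmul_mul_tmul, ha', mul_one]
    · refine (Ideal.span_singleton_le_iff_mem _).2 fun z hz => ?_
      have hfmem : f ∈ vanishing α D := hf ▸ Ideal.mem_span_singleton_self f
      rw [h.apply_tmul_one]
      exact hfmem _ hz

end IsProductOf

end VanishingFunctions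

/-! ### Prime divisors and principal ideals -/

section PrimeDivisors

theorem isPrimeDivisor_iff {X : Type*} [TopologicalSpace X]
    (hX : IsIrreducible (Set.univ : Set X)) {D : Set X} :
    IsPrimeDivisor D ↔ IsClosed D ∧ IsIrreducible D ∧ D ≠ Set.univ ∧
      ∀ E, IsClosed E → IsIrreducible E → D ⊆ E → E = D ∨ E = Set.univ := by
  let T : TopologicalSpace.IrreducibleCloseds X := ⟨Set.univ, hX, isClosed_univ⟩
  have hT : ∀ E : TopologicalSpace.IrreducibleCloseds X, IsMax E ↔ (E : Set X) = Set.univ := by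
    intro E
    constructor
    · intro hE
      exact Set.eq_univ_of_univ_subset (hE (show E ≤ T from Set.subset_univ _))
    · intro hE F _
      exact (Set.subset_univ _).trans hE.ge
  have key : ∀ E : TopologicalSpace.IrreducibleCloseds X, Order.coheight E = 1 ↔
      (E : Set X) ≠ Set.univ ∧ ∀ F, E < F → (F : Set X) = Set.univ := by
    intro E
    have h1 : Order.coheight E ≤ 1 ↔ ∀ F, E < F → (F : Set X) = Set.univ := by
      have := Order.coheight_le_coe_iff (x := E) (n := 1)
      rw [Nat.cast_one] at this
      rw [this]
      refine forall₂_congr fun F _ => ?_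
      rw [Order.lt_one_iff, Order.coheight_eq_zero, hT]
    rw [← h1, ne_eq, ← hT, ← Order.coheight_eq_zero, ← ne_eq, ← Order.one_le_iff_ne_zero, and_comm,
      le_antisymm_iff]
  constructor
  · rintro ⟨E, rfl, hE⟩
    obtain ⟨h1, h2⟩ := (key E).1 hE
    refine ⟨E.isClosed, E.isIrreducible, h1, fun F hF hF' hEF => ?_⟩
    by_cases h : F = E
    · exact Or.inl h
    · exact Or.inr (h2 ⟨F, hF', hF⟩ (lt_of_le_of_ne hEF fun h' =>
        h (congrArg (fun G : TopologicalSpace.IrreducibleCloseds X => (G : Set X)) h').symm))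
  · rintro ⟨h1, h2, h3, h4⟩
    refine ⟨⟨D, h2, h1⟩, rfl, (key _).2 ⟨h3, fun F hF => ?_⟩⟩
    refine (h4 F F.isClosed F.isIrreducible hF.le).resolve_left fun h => hF.ne ?_
    exact TopologicalSpace.IrreducibleCloseds.ext h.symm

/-- A set of elements that can be divided by `f` within the set is zero, by Krull's intersection
theorem. -/
theorem eq_zero_of_forall_exists_eq_mul {R : Type*} [CommRing R] [IsDomain R] [IsNoetherianRing R]
    {f : R} (hf : ¬ IsUnit f) {J : Set R} (hJ : ∀ g ∈ J, ∃ h ∈ J, g = f * h) {g : R} (hg : g ∈ J) :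
    g = 0 := by
  have h1 : ∀ n : ℕ, ∀ g ∈ J, g ∈ Ideal.span {f} ^ n := by
    intro n
    induction n with
    | zero => intro g _; simp
    | succ n ih =>
      intro g hg
      obtain ⟨h, hh, rfl⟩ := hJ g hg
      rw [pow_succ']
      exact Ideal.mul_mem_mul (Ideal.mem_span_singleton_self f) (ih h hh)
  have h2 : g ∈ ⨅ n : ℕ, Ideal.span {f} ^ n := (Ideal.mem_iInf).2 fun n => h1 n g hg
  rwa [Ideal.iInf_pow_eq_bot_of_isDomain _ (by rwa [ne_eq, Ideal.span_singleton_eq_top])] at h2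

variable {K : Type*} [Field K] {V : Type*} [AddCommGroup V] [Module K V]

/-- Hilbert's Nullstellensatz for a prime element of `K[V]`. -/
theorem dvd_of_forall_eq_zero [IsAlgClosed K] [FiniteDimensional K V] {p g : polyFun K V}
    (hp : Prime p) (h : ∀ v, (p : V → K) v = 0 → (g : V → K) v = 0) : p ∣ g := by
  let b := Module.finBasis K V
  have hp' : Prime ((polyEquiv b).symm p) := (MulEquiv.prime_iff (polyEquiv b).symm).2 hp
  have : (Ideal.span {(polyEquiv b).symm p}).IsPrime :=
    (Ideal.span_singleton_prime hp'.ne_zero).2 hp'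
  have h1 : (polyEquiv b).symm g ∈ MvPolynomial.vanishingIdeal K
      (MvPolynomial.zeroLocus K (Ideal.span {(polyEquiv b).symm p})) := by
    intro x hx
    have h2 := hx _ (Ideal.mem_span_singleton_self _)
    have hb : (b.repr (b.equivFun.symm x) : _ → K) = x := by
      ext i
      rw [← b.equivFun_apply, LinearEquiv.apply_symm_apply]
    rw [← hb] at h2 ⊢
    change MvPolynomial.eval _ _ = 0 at h2
    change MvPolynomial.eval _ _ = 0
    rw [eval_symm_apply] at h2 ⊢
    exact h _ h2
  rw [MvPolynomial.IsPrime.vanishingIdeal_zeroLocus, Ideal.mem_span_singleton] at h1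
  have h2 := map_dvd (polyEquiv b) h1
  rwa [AlgEquiv.apply_symm_apply, AlgEquiv.apply_symm_apply] at h2

theorem eq_univ_of_vanishing_eq_bot {D : Set V} (hD : @IsClosed V (zariski K V) D)
    (h : vanishing (polyFun K V).val D = ⊥) : D = Set.univ := by
  refine Set.eq_univ_of_forall fun v => isClosed_zariski_iff.1 hD v fun f hf => ?_
  have h1 : f ∈ vanishing (polyFun K V).val D := hf
  rw [h, Ideal.mem_bot] at h1
  rw [h1]
  rfl

theorem vanishing_isPrime {D : Set V} (hD : @IsIrreducible V (zariski K V) D) :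
    (vanishing (polyFun K V).val D).IsPrime := by
  obtain ⟨⟨v, hv⟩, h⟩ := isIrreducible_zariski_iff.1 hD
  refine ⟨fun htop => ?_, fun {f g} hfg => h f g hfg⟩
  have h1 : (1 : polyFun K V) ∈ vanishing (polyFun K V).val D := htop ▸ Submodule.mem_top
  exact one_ne_zero (h1 v hv)

/-- The prime divisors of `V` are the closed irreducible sets with principal nonzero ideal, since
`K[V]` is factorial. -/
theorem isPrimeDivisor_zariski_iff [IsAlgClosed K] [FiniteDimensional K V] {D : Set V}
    (hD : @IsClosed V (zariski K V) D) (hD' : @IsIrreducible V (zariski K V) D) :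
    @IsPrimeDivisor V (zariski K V) D ↔ (vanishing (polyFun K V).val D).IsPrincipal ∧
      vanishing (polyFun K V).val D ≠ ⊥ := by
  let := zariski K V
  have := isDomain_polyFun (K := K) (V := V)
  have := isNoetherianRing_polyFun (K := K) (V := V)
  have := uniqueFactorizationMonoid_polyFun (K := K) (V := V)
  rw [isPrimeDivisor_iff isIrreducible_univ_zariski]
  have hP := vanishing_isPrime hD'
  constructor
  · rintro ⟨-, -, h1, h2⟩
    have h0 : vanishing (polyFun K V).val D ≠ ⊥ := fun h => h1 (eq_univ_of_vanishing_eq_bot hD h)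
    refine ⟨?_, h0⟩
    obtain ⟨p, hpD, hp⟩ := hP.exists_mem_prime_of_ne_bot h0
    -- the hypersurface `p = 0` contains `D`, and is irreducible, so it is `D`
    let E : Set V := {v | ∀ f ∈ ({p} : Set (polyFun K V)), (f : V → K) v = 0}
    have hE : ∀ v, v ∈ E ↔ (p : V → K) v = 0 := fun v => by simp [E]
    have hDE : D ⊆ E := fun v hv => (hE v).2 (hpD v hv)
    have hEirr : IsIrreducible E := by
      refine isIrreducible_zariski_iff.2 ⟨hD'.1.mono hDE, fun f g hfg => ?_⟩
      have h3 : p ∣ f * g := dvd_of_forall_eq_zero hp fun v hv => hfg v ((hE v).2 hv)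
      rcases hp.dvd_or_dvd h3 with ⟨k, rfl⟩ | ⟨k, rfl⟩
      · exact Or.inl fun v hv => mul_eq_zero_of_left ((hE v).1 hv) _
      · exact Or.inr fun v hv => mul_eq_zero_of_left ((hE v).1 hv) _
    have hEne : E ≠ Set.univ := fun h => hp.ne_zero (polyFun_ext fun v => (hE v).1 (h ▸ trivial))
    have hED : E = D := (h2 E (isClosed_zeros _) hEirr hDE).resolve_right hEne
    refine ⟨p, le_antisymm (fun f hf => ?_) ((Ideal.span_singleton_le_iff_mem _).2 hpD)⟩
    exact Ideal.mem_span_singleton.2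
      (dvd_of_forall_eq_zero hp fun v hv => hf v (hED ▸ (hE v).2 hv))
  · rintro ⟨⟨f, hf⟩, h0⟩
    have hfmem : f ∈ vanishing (polyFun K V).val D := hf ▸ Ideal.mem_span_singleton_self f
    have hfu : ¬ IsUnit f := fun hu => hP.ne_top (Ideal.eq_top_of_isUnit_mem _ hfmem hu)
    refine ⟨hD, hD', fun h => h0 ?_, fun E hE hE' hDE => ?_⟩
    · rw [eq_bot_iff]
      intro g hg
      exact polyFun_ext fun v => hg v (h ▸ trivial)
    · have hQ := vanishing_isPrime hE'
      by_cases hfE : f ∈ vanishing (polyFun K V).val E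
      · refine Or.inl (Set.Subset.antisymm (fun v hv => ?_) hDE)
        refine isClosed_zariski_iff.1 hD v fun g hg => ?_
        have h1 : g ∈ vanishing (polyFun K V).val D := hg
        rw [hf] at h1
        obtain ⟨k, rfl⟩ := Ideal.mem_span_singleton'.1 h1
        exact mul_eq_zero_of_right _ (hfE v hv)
      · -- the prime ideal of `E` lies in `(f)` but does not contain `f`, so it is divisible by `f`
        refine Or.inr (eq_univ_of_vanishing_eq_bot hE (eq_bot_iff.2 fun g hg => ?_))
        refine eq_zero_of_forall_exists_eq_mul hfu
          (J := vanishing (polyFun K V).val E) (fun g hg => ?_) hg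
        have h1 : g ∈ vanishing (polyFun K V).val D := fun v hv => hg v (hDE hv)
        rw [hf] at h1
        obtain ⟨k, rfl⟩ := Ideal.mem_span_singleton'.1 h1
        exact ⟨k, (hQ.mem_or_mem hg).resolve_right hfE, mul_comm _ _⟩

/-- A closed subset of the spectrum of a subring `A` of a Noetherian domain `R` whose ideal is
prime, principal and nonzero, and contains no unit of `R`, is a prime divisor. -/
theorem isPrimeDivisor_of_isPrincipal {A R : Type*} [CommRing A] [IsDomain A]
    [CommRing R] [IsDomain R] [IsNoetherianRing R] (φ : A →+* R) (hφ : Function.Injective φ)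
    {D : Set (PrimeSpectrum A)} (hD : IsClosed D) {P : Ideal A}
    (hDP : PrimeSpectrum.vanishingIdeal D = P) (hP : P.IsPrincipal) (hP0 : P ≠ ⊥)
    (hPp : P.IsPrime) (hu : ∀ f ∈ P, ¬ IsUnit (φ f)) : IsPrimeDivisor D := by
  obtain ⟨f, rfl⟩ := hP
  have hf : PrimeSpectrum.vanishingIdeal D = Ideal.span {f} := hDP
  have hfu := hu f (Ideal.mem_span_singleton_self f)
  have hf0 : f ≠ 0 := fun h => hP0 (Ideal.span_singleton_eq_bot.2 h)
  have hcl : ∀ {E : Set (PrimeSpectrum A)}, IsClosed E →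
      PrimeSpectrum.zeroLocus (PrimeSpectrum.vanishingIdeal E) = E := fun hE => by
    rw [PrimeSpectrum.zeroLocus_vanishingIdeal_eq_closure, hE.closure_eq]
  have hbot : ∀ {E : Set (PrimeSpectrum A)}, IsClosed E →
      PrimeSpectrum.vanishingIdeal E = ⊥ → E = Set.univ := fun hE h => by
    rw [← hcl hE, h]
    simp
  have huniv : PrimeSpectrum.vanishingIdeal (Set.univ : Set (PrimeSpectrum A)) = ⊥ := by
    rw [eq_bot_iff]
    intro g hg
    exact (PrimeSpectrum.mem_vanishingIdeal _ _).1 hg ⟨⊥, Ideal.isPrime_bot⟩ trivial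
  rw [isPrimeDivisor_iff (by
    rw [PrimeSpectrum.isIrreducible_iff_vanishingIdeal_isPrime, huniv]
    exact Ideal.isPrime_bot)]
  refine ⟨hD, ?_, fun h => ?_, fun E hE hE' hDE => ?_⟩
  · rw [PrimeSpectrum.isIrreducible_iff_vanishingIdeal_isPrime, hf]
    exact hPp
  · rw [h, huniv, eq_comm, Ideal.span_singleton_eq_bot] at hf
    exact hf0 hf
  · have hQ := PrimeSpectrum.isIrreducible_iff_vanishingIdeal_isPrime.1 hE'
    have hle : PrimeSpectrum.vanishingIdeal E ≤ Ideal.span {f} :=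
      hf ▸ PrimeSpectrum.vanishingIdeal_anti_mono hDE
    by_cases hfE : f ∈ PrimeSpectrum.vanishingIdeal E
    · refine Or.inl ?_
      rw [← hcl hE, ← hcl hD, hf,
        le_antisymm hle ((Ideal.span_singleton_le_iff_mem _).2 hfE)]
    · refine Or.inr (hbot hE (eq_bot_iff.2 fun g hg => ?_))
      refine (map_eq_zero_iff φ hφ).1 (eq_zero_of_forall_exists_eq_mul hfu
        (J := φ '' (PrimeSpectrum.vanishingIdeal E : Set A)) ?_ ⟨g, hg, rfl⟩)
      rintro _ ⟨g, hg, rfl⟩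
      obtain ⟨k, rfl⟩ := Ideal.mem_span_singleton'.1 (hle hg)
      exact ⟨φ k, ⟨k, (hQ.mem_or_mem hg).resolve_right hfE, rfl⟩, by rw [map_mul, mul_comm]⟩

variable {r : ℕ} (ρ : Representation K (Torus K r) V)

/-- Invariants as functions on `V`. -/
def invariantEval : invariants ρ →ₐ[K] (V → K) := (polyFun K V).val.comp (invariants ρ).val

theorem invariantEval_injective : Function.Injective (invariantEval ρ) :=
  Subtype.val_injective.comp Subtype.val_injective

theorem vanishingIdeal_image (D : Set V) :
    PrimeSpectrum.vanishingIdeal (image ρ D) = vanishing (A := invariants ρ) (invariantEval ρ) D := by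
  rw [image, PrimeSpectrum.vanishingIdeal_closure]
  ext f
  rw [PrimeSpectrum.mem_vanishingIdeal, Set.forall_mem_image]
  rfl

/-- For an irreducible set `D`, a principal image in `V/T` is a prime divisor if and only if it is
not all of `V/T`. -/
theorem isPrimeDivisor_image_iff [Infinite K] [FiniteDimensional K V] {D : Set V}
    (hD : @IsIrreducible V (zariski K V) D)
    (hP : (vanishing (A := invariants ρ) (invariantEval ρ) D).IsPrincipal) :
    IsPrimeDivisor (image ρ D) ↔ vanishing (A := invariants ρ) (invariantEval ρ) D ≠ ⊥ := by
  have := isDomain_polyFun (K := K) (V := V)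
  have := isNoetherianRing_polyFun (K := K) (V := V)
  have : IsDomain (invariants ρ) := Subalgebra.isDomain _
  constructor
  · rintro ⟨E, hE, hE1⟩ h0
    have hu : image ρ D = Set.univ := by
      have h1 := PrimeSpectrum.zeroLocus_vanishingIdeal_eq_closure (image ρ D)
      rw [vanishingIdeal_image, h0, image, closure_closure] at h1
      rw [image, ← h1]
      simp
    have hmax : IsMax E := fun F _ => (Set.subset_univ _).trans (hE.trans hu).ge
    rw [Order.coheight_eq_zero.2 hmax] at hE1
    exact zero_ne_one hE1
  · intro h0
    have hcl : IsClosed (image ρ D) := isClosed_closure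
    refine isPrimeDivisor_of_isPrincipal (invariants ρ).val.toRingHom Subtype.val_injective hcl
      (vanishingIdeal_image ρ D) hP h0
      ((vanishing_isPrime hD).comap (invariants ρ).val.toRingHom) fun f hf hu => ?_
    exact (vanishing_isPrime hD).ne_top
      (Ideal.eq_top_of_isUnit_mem _ (show (f : polyFun K V) ∈ _ from hf) hu)

end PrimeDivisors

/-! ### Irreducible components of the strictly semi-stable locus -/

section Components

variable {X : Type*} [TopologicalSpace X]

theorem exists_isComponentOf_ge {E Z : Set X} (hE : IsIrreducible E) (hEZ : E ⊆ Z) :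
    ∃ D, IsComponentOf D Z ∧ E ⊆ D := by
  obtain ⟨D, hED, hD⟩ := zorn_subset_nonempty {E : Set X | IsIrreducible E ∧ E ⊆ Z}
    (fun c hc hchain hne => by
      refine ⟨⋃₀ c, ⟨⟨?_, ?_⟩, Set.sUnion_subset fun s hs => (hc hs).2⟩,
        fun s hs => Set.subset_sUnion_of_mem hs⟩
      · obtain ⟨s, hs⟩ := hne
        exact (hc hs).1.1.mono (Set.subset_sUnion_of_mem hs)
      · rintro u v hu hv ⟨x, ⟨s, hs, hxs⟩, hxu⟩ ⟨y, ⟨t, ht, hyt⟩, hyv⟩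
        rcases hchain.total hs ht with h | h
        · obtain ⟨z, hz, hzuv⟩ := (hc ht).1.2 u v hu hv ⟨x, h hxs, hxu⟩ ⟨y, hyt, hyv⟩
          exact ⟨z, ⟨t, ht, hz⟩, hzuv⟩
        · obtain ⟨z, hz, hzuv⟩ := (hc hs).1.2 u v hu hv ⟨x, hxs, hxu⟩ ⟨y, h hyt, hyv⟩
          exact ⟨z, ⟨s, hs, hz⟩, hzuv⟩) E ⟨hE, hEZ⟩
  exact ⟨D, hD, hED⟩

theorem IsComponentOf.isClosed {D Z : Set X} (h : IsComponentOf D Z) (hZ : IsClosed Z) :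
    IsClosed D := by
  have h1 : closure D ⊆ D :=
    h.2 ⟨h.1.1.closure, closure_minimal h.1.2 hZ⟩ subset_closure
  exact closure_subset_iff_isClosed.1 h1

variable {T : Type*} [TopologicalSpace T] {p : T → X} {Z : Set X} {Z' : Set T}

theorem IsComponentOf.preimage_union (hp : Continuous p) (hsurj : Function.Surjective p)
    (hirr : ∀ D : Set X, IsIrreducible D → IsIrreducible (p ⁻¹' D)) (hZ : IsClosed Z)
    (hZ' : IsClosed Z') (hZZ' : ∀ x, ¬ p ⁻¹' {x} ⊆ Z') {D : Set X} (hD : IsComponentOf D Z) :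
    IsComponentOf (p ⁻¹' D) (p ⁻¹' Z ∪ Z') := by
  refine ⟨⟨hirr D hD.1.1, (Set.preimage_mono hD.1.2).trans Set.subset_union_left⟩, ?_⟩
  rintro E ⟨hE, hEZ⟩ hDE
  rcases (isPreirreducible_iff_isClosed_union_isClosed.1 hE.2) _ _ (hZ.preimage hp) hZ' hEZ
    with h | h
  · have h1 : p '' E ⊆ D := hD.2 ⟨hE.image p hp.continuousOn, Set.image_subset_iff.2 h⟩
      fun x hx => by
        obtain ⟨z, rfl⟩ := hsurj x
        exact ⟨z, hDE hx, rfl⟩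
    exact Set.image_subset_iff.1 h1
  · obtain ⟨x, hx⟩ := hD.1.1.1
    exact absurd ((Set.preimage_mono (Set.singleton_subset_iff.2 hx)).trans
      (Set.Subset.trans hDE h)) (hZZ' x)

theorem IsComponentOf.exists_eq_preimage (hp : Continuous p)
    (hirr : ∀ D : Set X, IsIrreducible D → IsIrreducible (p ⁻¹' D)) {D : Set T}
    (hD : IsComponentOf D (p ⁻¹' Z ∪ Z')) (hDZ : D ⊆ p ⁻¹' Z) :
    ∃ D₁, IsComponentOf D₁ Z ∧ D = p ⁻¹' D₁ := by
  obtain ⟨D₁, hD₁, hDD₁⟩ := exists_isComponentOf_ge (hD.1.1.image p hp.continuousOn)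
    (Set.image_subset_iff.2 hDZ)
  refine ⟨D₁, hD₁, Set.Subset.antisymm (Set.image_subset_iff.1 hDD₁) ?_⟩
  exact hD.2 ⟨hirr D₁ hD₁.1.1, (Set.preimage_mono hD₁.1.2).trans Set.subset_union_left⟩
    (Set.image_subset_iff.1 hDD₁)

/-- The components of a union of cylinders over two factors are the cylinders over the
components. -/
theorem isComponentOf_union_iff {Y : Type*} [TopologicalSpace Y] {q : T → Y} {Z₂ : Set Y}
    (hp : Continuous p) (hq : Continuous q) (hpq : ∀ x y, ∃ z, p z = x ∧ q z = y)
    (hpirr : ∀ D : Set X, IsIrreducible D → IsIrreducible (p ⁻¹' D))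
    (hqirr : ∀ D : Set Y, IsIrreducible D → IsIrreducible (q ⁻¹' D))
    (hZ : IsClosed Z) (hZ₂ : IsClosed Z₂) {x₀ : X} {y₀ : Y} (hx₀ : x₀ ∉ Z) (hy₀ : y₀ ∉ Z₂)
    (D : Set T) : IsComponentOf D (p ⁻¹' Z ∪ q ⁻¹' Z₂) ↔
      (∃ D₁, IsComponentOf D₁ Z ∧ D = p ⁻¹' D₁) ∨ ∃ D₂, IsComponentOf D₂ Z₂ ∧ D = q ⁻¹' D₂ := by
  constructor
  · intro hD
    rcases (isPreirreducible_iff_isClosed_union_isClosed.1 hD.1.1.2) _ _ (hZ.preimage hp)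
      (hZ₂.preimage hq) hD.1.2 with h | h
    · exact Or.inl (hD.exists_eq_preimage hp hpirr h)
    · rw [Set.union_comm] at hD
      exact Or.inr (hD.exists_eq_preimage hq hqirr h)
  · rintro (⟨D₁, hD₁, rfl⟩ | ⟨D₂, hD₂, rfl⟩)
    · refine hD₁.preimage_union hp (fun x => ?_) hpirr hZ (hZ₂.preimage hq) fun x h => ?_
      · obtain ⟨z, hz, -⟩ := hpq x y₀
        exact ⟨z, hz⟩
      · obtain ⟨z, hz, rfl⟩ := hpq x y₀
        exact hy₀ (h hz)
    · rw [Set.union_comm]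
      refine hD₂.preimage_union hq (fun y => ?_) hqirr hZ₂ (hZ.preimage hp) fun y h => ?_
      · obtain ⟨z, -, hz⟩ := hpq x₀ y
        exact ⟨z, hz⟩
      · obtain ⟨z, rfl, hz⟩ := hpq x₀ y
        exact hx₀ (h hz)

end Components

/-! ### Direct sum decompositions and polynomial functions -/

section DirectSum

variable {K : Type*} [Field K] {V : Type*} [AddCommGroup V] [Module K V]
  {W : Type*} [AddCommGroup W] [Module K W] {U : Type*} [AddCommGroup U] [Module K U]

/-- Composition with an affine map sends polynomial functions to polynomial functions. -/
theorem comp_add_mem_polyFun (p : V →ₗ[K] W) (c : W) {f : W → K} (hf : f ∈ polyFun K W) :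
    (fun v => f (p v + c)) ∈ polyFun K V := by
  induction hf using Algebra.adjoin_induction with
  | mem f hf =>
    obtain ⟨φ, rfl⟩ := hf
    have : (fun v => φ (p v + c)) = ((φ.comp p : Module.Dual K V) : V → K) +
        algebraMap K (V → K) (φ c) := by
      ext v
      simp
    simp only [this]
    exact (polyFun K V).add_mem (Algebra.subset_adjoin ⟨φ.comp p, rfl⟩)
      ((polyFun K V).algebraMap_mem _)
  | algebraMap a => exact (polyFun K V).algebraMap_mem a
  | add f g _ _ hf hg => exact (polyFun K V).add_mem hf hg
  | mul f g _ _ hf hg => exact (polyFun K V).mul_mem hf hg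

/-- The pull-back of polynomial functions along a linear map. -/
def polyPullback (p : V →ₗ[K] W) : polyFun K W →ₐ[K] polyFun K V where
  toFun f := ⟨fun v => (f : W → K) (p v), comp_mem_polyFun p f.2⟩
  map_one' := rfl
  map_mul' _ _ := rfl
  map_zero' := rfl
  map_add' _ _ := rfl
  commutes' _ := rfl

theorem continuous_zariski (p : V →ₗ[K] W) :
    @Continuous V W (zariski K V) (zariski K W) p := by
  let := zariski K V
  let := zariski K W
  refine continuous_iff_isClosed.2 fun Z hZ => isClosed_zariski_iff.2 fun v hv => ?_
  exact isClosed_zariski_iff.1 hZ _ fun f hf => hv (polyPullback p f) fun w hw => hf _ hw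

/-- `U` is the internal direct sum of `V` and `W`, with projections `p`, `q` and inclusions
`i`, `j`. -/
structure IsDirectSum (p : U →ₗ[K] V) (q : U →ₗ[K] W) (i : V →ₗ[K] U) (j : W →ₗ[K] U) : Prop where
  sum_eq : ∀ u, i (p u) + j (q u) = u
  fst_add : ∀ v w, p (i v + j w) = v
  snd_add : ∀ v w, q (i v + j w) = w

theorem isDirectSum_prod : IsDirectSum (LinearMap.fst K V W) (LinearMap.snd K V W)
    (LinearMap.inl K V W) (LinearMap.inr K V W) :=
  ⟨fun u => by simp, fun v w => by simp, fun v w => by simp⟩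

namespace IsDirectSum

variable {p : U →ₗ[K] V} {q : U →ₗ[K] W} {i : V →ₗ[K] U} {j : W →ₗ[K] U}

theorem symm (h : IsDirectSum p q i j) : IsDirectSum q p j i :=
  ⟨fun u => by rw [add_comm, h.sum_eq], fun v w => by rw [add_comm, h.snd_add],
    fun v w => by rw [add_comm, h.fst_add]⟩

/-- The product of an irreducible set with a vector space is irreducible. -/
theorem isIrreducible_preimage [Infinite K] [FiniteDimensional K W] (h : IsDirectSum p q i j)
    {D : Set V} (hD : @IsIrreducible V (zariski K V) D) :
    @IsIrreducible U (zariski K U) (p ⁻¹' D) := by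
  rw [isIrreducible_zariski_iff] at hD ⊢
  obtain ⟨⟨d, hd⟩, hD⟩ := hD
  refine ⟨⟨i d + j 0, by rwa [Set.mem_preimage, h.fst_add]⟩, fun f g hfg => ?_⟩
  by_contra hcon
  push Not at hcon
  obtain ⟨⟨u, hu, hfu⟩, u', hu', hgu'⟩ := hcon
  have hW := (isIrreducible_zariski_iff.1 (isIrreducible_univ_zariski (K := K) (V := W))).2
    ⟨fun w => (f : U → K) (j w + i (p u)), comp_add_mem_polyFun j (i (p u)) f.2⟩
    ⟨fun w => (g : U → K) (j w + i (p u')), comp_add_mem_polyFun j (i (p u')) g.2⟩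
  -- some slice of `p ⁻¹' D` meets both the locus `f ≠ 0` and the locus `g ≠ 0`
  have hy : ∃ w, (f : U → K) (j w + i (p u)) ≠ 0 ∧ (g : U → K) (j w + i (p u')) ≠ 0 := by
    by_contra hno
    push Not at hno
    rcases hW fun w _ => by
        by_cases hw : (f : U → K) (j w + i (p u)) = 0
        · exact mul_eq_zero_of_left hw _
        · exact mul_eq_zero_of_right _ (hno w hw) with h1 | h1
    · apply hfu
      have := h1 (q u) trivial
      simpa only [add_comm (j _), h.sum_eq] using this
    · apply hgu'
      have := h1 (q u') trivial
      simpa only [add_comm (j _), h.sum_eq] using this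
  obtain ⟨w, hw1, hw2⟩ := hy
  rcases hD ⟨fun v => (f : U → K) (i v + j w), comp_add_mem_polyFun i (j w) f.2⟩
    ⟨fun v => (g : U → K) (i v + j w), comp_add_mem_polyFun i (j w) g.2⟩
    (fun v hv => hfg _ (by rwa [Set.mem_preimage, h.fst_add])) with h1 | h1
  · apply hw1
    rw [add_comm]
    exact h1 _ hu
  · apply hw2
    rw [add_comm]
    exact h1 _ hu'

theorem isProductOf_polyFun (h : IsDirectSum p q i j) :
    IsProductOf (polyFun K V).val (polyFun K W).val (polyFun K U).val p q
      (Algebra.TensorProduct.productMap (polyPullback p) (polyPullback q)) where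
  injective_left := Subtype.val_injective
  injective_right := Subtype.val_injective
  injective := Subtype.val_injective
  surjective := by
    rw [← AlgHom.range_eq_top, eq_top_iff]
    rintro ⟨f, hf⟩ -
    have h1 : polyFun K U ≤ ((polyFun K U).val.comp
        (Algebra.TensorProduct.productMap (polyPullback p) (polyPullback q))).range := by
      refine Algebra.adjoin_le ?_
      rintro _ ⟨φ, rfl⟩
      refine ⟨⟨_, Algebra.subset_adjoin ⟨φ.comp i, rfl⟩⟩ ⊗ₜ 1 +
        1 ⊗ₜ ⟨_, Algebra.subset_adjoin ⟨φ.comp j, rfl⟩⟩, ?_⟩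
      ext u
      simp only [map_add]
      change φ (i (p u)) * 1 + 1 * φ (j (q u)) = φ u
      rw [mul_one, one_mul, ← map_add, h.sum_eq]
    obtain ⟨t, ht⟩ := h1 hf
    exact ⟨t, Subtype.ext ht⟩
  apply_tmul _ _ _ := rfl
  exists_point v w := ⟨i v + j w, h.fst_add v w, h.snd_add v w⟩

end IsDirectSum

variable {r : ℕ} {ρ : Representation K (Torus K r) V} {σ : Representation K (Torus K r) W}

theorem isProductOf_comparison (h : Function.Surjective (comparison ρ σ)) :
    IsProductOf (A := invariants ρ) (B := invariants σ) (C := invariants (ρ.prod σ))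
      (invariantEval ρ) (invariantEval σ) (invariantEval (ρ.prod σ)) Prod.fst Prod.snd
      (comparison ρ σ) where
  injective_left := invariantEval_injective ρ
  injective_right := invariantEval_injective σ
  injective := invariantEval_injective _
  surjective := h
  apply_tmul _ _ _ := rfl
  exists_point v w := ⟨(v, w), rfl, rfl⟩

theorem IsProductOf.symm {A B C X Y Z : Type*} [CommRing A] [Algebra K A] [CommRing B] [Algebra K B]
    [CommRing C] [Algebra K C] {α : A →ₐ[K] (X → K)} {β : B →ₐ[K] (Y → K)} {γ : C →ₐ[K] (Z → K)}
    {p : Z → X} {q : Z → Y} {μ : A ⊗[K] B →ₐ[K] C} (h : IsProductOf α β γ p q μ) :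
    IsProductOf β α γ q p (μ.comp (Algebra.TensorProduct.comm K B A).toAlgHom) where
  injective_left := h.injective_right
  injective_right := h.injective_left
  injective := h.injective
  surjective := h.surjective.comp (Algebra.TensorProduct.comm K B A).surjective
  apply_tmul a b z := (h.apply_tmul b a z).trans (mul_comm _ _)
  exists_point y x := (h.exists_point x y).imp fun _ hz => hz.symm

variable {ι₁ ι₂ : Type*} {b₁ : Module.Basis ι₁ K V} {b₂ : Module.Basis ι₂ K W}
  {χ₁ : ι₁ → Fin r → ℤ} {χ₂ : ι₂ → Fin r → ℤ}

theorem IsWeightBasis.prod (h₁ : IsWeightBasis ρ b₁ χ₁) (h₂ : IsWeightBasis σ b₂ χ₂) :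
    IsWeightBasis (ρ.prod σ) (b₁.prod b₂) (Sum.elim χ₁ χ₂) := by
  rintro t (i | i)
  · ext <;> simp [h₁ t i]
  · ext <;> simp [h₂ t i]

theorem weightsSplit [CharZero K] [Fintype ι₁] [Fintype ι₂] (h₁ : IsWeightBasis ρ b₁ χ₁)
    (h₂ : IsWeightBasis σ b₂ χ₂) (h : Function.Surjective (comparison ρ σ)) :
    WeightsSplit χ₁ χ₂ := by
  intro a₁ a₂ ha
  have h1 : weight χ₁ a₁ = 0 := by
    rw [← weight_sumElim, ← monomialFun_mem_invariants_iff (h₁.prod h₂)] at ha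
    -- restrict the monomial to the slice through the vector with all coordinates equal to `1`
    obtain ⟨f, hf⟩ := (isProductOf_comparison h).exists_slice ⟨_, ha⟩ (b₂.equivFun.symm 1)
    rw [← monomialFun_mem_invariants_iff h₁]
    convert f.2
    refine polyFun_ext fun v => ?_
    refine Eq.trans ?_ (hf (v, _) rfl)
    change (monomialFun b₁ a₁ : V → K) v =
      (monomialFun (b₁.prod b₂) (a₁.sumElim a₂) : V × W → K) (v, _)
    rw [monomialFun_apply, monomialFun_apply, Fintype.prod_sum_type]
    simp
  rw [h1, zero_add] at ha
  exact ⟨h1, ha⟩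

theorem isStableVector_prod_iff [IsAlgClosed K] [CharZero K] [Fintype ι₁] [Fintype ι₂]
    (h₁ : IsWeightBasis ρ b₁ χ₁) (h₂ : IsWeightBasis σ b₂ χ₂)
    (h : Function.Surjective (comparison ρ σ)) (v : V) (w : W) :
    IsStableVector (ρ.prod σ) (v, w) ↔ IsStableVector ρ v ∧ IsStableVector σ w := by
  rw [isStableVector_iff h₁, isStableVector_iff h₂, isStableVector_iff (h₁.prod h₂),
    (weightsSplit h₁ h₂ h).isStableSupport_iff]
  simp

end DirectSum

/-! ### Cnpure representations -/

section Cnpure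

variable {K : Type*} [Field K] {r : ℕ} {V : Type*} [AddCommGroup V] [Module K V]

/-- Both the ideal of `D` in `K[V]` and the ideal of its image in `K[V]^T` are principal and
nonzero. -/
def IsDoublyPrincipal (ρ : Representation K (Torus K r) V) (D : Set V) : Prop :=
  ((vanishing (polyFun K V).val D).IsPrincipal ∧ vanishing (polyFun K V).val D ≠ ⊥) ∧
    (vanishing (A := invariants ρ) (invariantEval ρ) D).IsPrincipal ∧
      vanishing (A := invariants ρ) (invariantEval ρ) D ≠ ⊥

theorem isCnpure_iff [IsAlgClosed K] [FiniteDimensional K V]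
    {ρ : Representation K (Torus K r) V} (hs : IsStable ρ)
    (hcl : @IsClosed V (zariski K V) (sss ρ)) :
    IsCnpure ρ ↔
      ∀ D, @IsComponentOf V (zariski K V) D (sss ρ) → IsDoublyPrincipal ρ D := by
  let := zariski K V
  have h1 : ∀ D, IsComponentOf D (sss ρ) → (IsPrimeDivisor D ↔
      (vanishing (polyFun K V).val D).IsPrincipal ∧ vanishing (polyFun K V).val D ≠ ⊥) :=
    fun D hD => isPrimeDivisor_zariski_iff (hD.isClosed hcl) hD.1.1
  constructor
  · rintro ⟨⟨⟨-, hp⟩, hn⟩, hc⟩ D hD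
    have h2 := hc D hD
    rw [vanishingIdeal_image] at h2
    exact ⟨(h1 D hD).1 (hp D hD), h2, (isPrimeDivisor_image_iff ρ hD.1.1 h2).1 (hn D hD)⟩
  · intro h
    refine ⟨⟨⟨hs, fun D hD => (h1 D hD).2 (h D hD).1⟩, fun D hD => ?_⟩, fun D hD => ?_⟩
    · exact (isPrimeDivisor_image_iff ρ hD.1.1 (h D hD).2.1).2 (h D hD).2.2
    · rw [vanishingIdeal_image]
      exact (h D hD).2.1

variable {W : Type*} [AddCommGroup W] [Module K W]
  {ρ : Representation K (Torus K r) V} {σ : Representation K (Torus K r) W}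

theorem isDoublyPrincipal_preimage_fst (h : Function.Surjective (comparison ρ σ)) (D : Set V) :
    IsDoublyPrincipal (ρ.prod σ) (Prod.fst ⁻¹' D) ↔ IsDoublyPrincipal ρ D := by
  have h1 := (isDirectSum_prod (K := K) (V := V) (W := W)).isProductOf_polyFun
  have h2 := isProductOf_comparison h
  exact and_congr
    (and_congr (h1.isPrincipal_vanishing_iff D) (not_congr (h1.vanishing_eq_bot_iff D)))
    (and_congr (h2.isPrincipal_vanishing_iff D) (not_congr (h2.vanishing_eq_bot_iff D)))

theorem isDoublyPrincipal_preimage_snd (h : Function.Surjective (comparison ρ σ)) (D : Set W) :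
    IsDoublyPrincipal (ρ.prod σ) (Prod.snd ⁻¹' D) ↔ IsDoublyPrincipal σ D := by
  have h1 := (isDirectSum_prod (K := K) (V := V) (W := W)).isProductOf_polyFun.symm
  have h2 := (isProductOf_comparison h).symm
  exact and_congr
    (and_congr (h1.isPrincipal_vanishing_iff D) (not_congr (h1.vanishing_eq_bot_iff D)))
    (and_congr (h2.isPrincipal_vanishing_iff D) (not_congr (h2.vanishing_eq_bot_iff D)))

end Cnpure

end

end TorusRep

open TorusRep in
theorem mainTheorem8 {K : Type*} [Field K] [IsAlgClosed K] [CharZero K] (r : ℕ)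
    {V₁ : Type*} [AddCommGroup V₁] [Module K V₁] [FiniteDimensional K V₁]
    {V₂ : Type*} [AddCommGroup V₂] [Module K V₂] [FiniteDimensional K V₂]
    (ρ₁ : Representation K (TorusRep.Torus K r) V₁)
    (ρ₂ : Representation K (TorusRep.Torus K r) V₂)
    (hρ₁ : TorusRep.IsAlgebraic ρ₁) (hρ₂ : TorusRep.IsAlgebraic ρ₂)
    (hs₁ : TorusRep.IsStable ρ₁) (hs₂ : TorusRep.IsStable ρ₂)
    (hprod : TorusRep.QuotientIsProduct ρ₁ ρ₂) :
    (TorusRep.IsCofree (ρ₁.prod ρ₂) ↔ TorusRep.IsCofree ρ₁ ∧ TorusRep.IsCofree ρ₂) ∧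
      (TorusRep.IsCnpure (ρ₁.prod ρ₂) ↔ TorusRep.IsCnpure ρ₁ ∧ TorusRep.IsCnpure ρ₂) := by
  obtain ⟨n₁, b₁, χ₁, h₁⟩ := exists_isWeightBasis ρ₁ hρ₁
  obtain ⟨n₂, b₂, χ₂, h₂⟩ := exists_isWeightBasis ρ₂ hρ₂
  have hsurj : Function.Surjective (comparison ρ₁ ρ₂) := hprod.2
  have hsplit := weightsSplit h₁ h₂ hsurj
  refine ⟨?_, ?_⟩
  · rw [isCofree_iff h₁, isCofree_iff h₂, isCofree_iff (h₁.prod h₂),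
      hsplit.hasUniqueDecomposition_iff]
  · have hstab := isStableVector_prod_iff h₁ h₂ hsurj
    obtain ⟨v₁, hv₁⟩ := hs₁
    obtain ⟨v₂, hv₂⟩ := hs₂
    have hs : IsStable (ρ₁.prod ρ₂) := ⟨(v₁, v₂), (hstab v₁ v₂).2 ⟨hv₁, hv₂⟩⟩
    have hsss : sss (ρ₁.prod ρ₂) = Prod.fst ⁻¹' sss ρ₁ ∪ Prod.snd ⁻¹' sss ρ₂ := by
      ext ⟨v, w⟩
      exact (not_congr (hstab v w)).trans not_and_or
    have hcomp : ∀ D, @IsComponentOf _ (zariski K (V₁ × V₂)) D (sss (ρ₁.prod ρ₂)) ↔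
        (∃ D₁, @IsComponentOf _ (zariski K V₁) D₁ (sss ρ₁) ∧ D = Prod.fst ⁻¹' D₁) ∨
          ∃ D₂, @IsComponentOf _ (zariski K V₂) D₂ (sss ρ₂) ∧ D = Prod.snd ⁻¹' D₂ := by
      rw [hsss]
      have hds := isDirectSum_prod (K := K) (V := V₁) (W := V₂)
      exact @isComponentOf_union_iff V₁ (zariski K V₁) (V₁ × V₂) (zariski K (V₁ × V₂)) Prod.fst
        (sss ρ₁) V₂ (zariski K V₂) Prod.snd (sss ρ₂)
        (continuous_zariski (LinearMap.fst K V₁ V₂)) (continuous_zariski (LinearMap.snd K V₁ V₂))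
        (fun v w => ⟨(v, w), rfl, rfl⟩) (fun D hD => hds.isIrreducible_preimage hD)
        (fun D hD => hds.symm.isIrreducible_preimage hD) (isClosed_sss h₁) (isClosed_sss h₂)
        v₁ v₂ (not_not.2 hv₁) (not_not.2 hv₂)
    rw [isCnpure_iff hs (isClosed_sss (h₁.prod h₂)), isCnpure_iff ⟨v₁, hv₁⟩ (isClosed_sss h₁),
      isCnpure_iff ⟨v₂, hv₂⟩ (isClosed_sss h₂)]
    constructor
    · intro h
      exact ⟨fun D hD => (isDoublyPrincipal_preimage_fst hsurj D).1
          (h _ ((hcomp _).2 (Or.inl ⟨D, hD, rfl⟩))),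
        fun D hD => (isDoublyPrincipal_preimage_snd hsurj D).1
          (h _ ((hcomp _).2 (Or.inr ⟨D, hD, rfl⟩)))⟩
    · rintro ⟨h1, h2⟩ D hD
      rcases (hcomp D).1 hD with ⟨D₁, hD₁, rfl⟩ | ⟨D₂, hD₂, rfl⟩
      · exact (isDoublyPrincipal_preimage_fst hsurj D₁).2 (h1 D₁ hD₁)
      · exact (isDoublyPrincipal_preimage_snd hsurj D₂).2 (h2 D₂ hD₂)
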